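/- Let $X$ be a real Banach space whose dual $X^*$ is linearly isometric to $\ell_1$. Let $c$ denote the Banach space of all convergent real sequences with the supremum norm. Let $S_X$, $S_{X^*}$ be the unit spheres of $X$ and $X^*$, let $B_{X^*}$ be the closed unit ball of $X^*$, let $\operatorname{ext}(B_{X^*})$ be the set of its extreme points, and for $x \in S_X$ put $D(x) = \{x^* \in S_{X^*} : x^*(x) = 1\}$. Then the following are equivalent: 1. $X$ is polyhedral, that is, the closed unit ball of every finite-dimensional subspace of $X$ is a polytope (the convex hull of a finite set); 2. $X$ contains no isometric copy of $c$, that is, there is no linear isometric embedding of $c$ into $X$; 3. (property (BD)) for every $x \in S_X$, $$\sup\{x^*(x) : x^* \in \operatorname{ext}(B_{X^*}) \setminus D(x)\} < 1.$$ -/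

import Mathlib

open scoped ENNReal

/-- The Banach space `c` of all real convergent sequences, with the supremum norm, realised as a
subspace of the space of bounded real sequences. -/
def ConvergentSeq : Submodule ℝ (lp (fun _ : ℕ => ℝ) ∞) where
  carrier := {x | ∃ a : ℝ, Filter.Tendsto (fun n : ℕ => x n) Filter.atTop (nhds a)}
  add_mem' := by
    rintro x y ⟨a, ha⟩ ⟨b, hb⟩
    exact ⟨a + b, ha.add hb⟩
  zero_mem' := ⟨0, tendsto_const_nhds⟩
  smul_mem' := by
    rintro r x ⟨a, ha⟩
    exact ⟨r * a, ha.const_mul r⟩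

/-- `X` is a predual of `ℓ₁`: its dual is linearly isometric to the space of absolutely summable
real sequences. -/
def IsPredualL1 (X : Type*) [NormedAddCommGroup X] [NormedSpace ℝ X] : Prop :=
  Nonempty (StrongDual ℝ X ≃ₗᵢ[ℝ] lp (fun _ : ℕ => ℝ) 1)

/-- A polytope is the convex hull of a finite set. -/
def IsPolytope {V : Type*} [AddCommGroup V] [Module ℝ V] (K : Set V) : Prop :=
  ∃ s : Set V, s.Finite ∧ K = convexHull ℝ s

/-- A normed space is polyhedral if the unit balls of all its finite-dimensional subspaces are
polytopes. -/
def IsPolyhedral (X : Type*) [NormedAddCommGroup X] [NormedSpace ℝ X] : Prop :=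
  ∀ F : Submodule ℝ X, FiniteDimensional ℝ F → IsPolytope (Metric.closedBall (0 : F) 1)

/-- `X` contains an isometric copy of `c`: there is a linear, norm preserving (not necessarily
surjective) map from `c` to `X`. -/
def ContainsIsometricCopyOfC (X : Type*) [NormedAddCommGroup X] [NormedSpace ℝ X] : Prop :=
  Nonempty (ConvergentSeq →ₗᵢ[ℝ] X)

/-- `D(x)`, the set of norm one functionals with value `1` at `x`. -/
def dualFace {X : Type*} [NormedAddCommGroup X] [NormedSpace ℝ X] (x : X) :
    Set (StrongDual ℝ X) :=
  {f | f ∈ Metric.sphere (0 : StrongDual ℝ X) 1 ∧ f x = 1}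

/-- Property (BD): for each `x` in the unit sphere, the supremum of the values `f x` over the
extreme points `f` of the dual unit ball outside `D(x)` is less than `1`. (These values are
bounded above by `1`, and there is at least one when the dual ball has an extreme point `f`,
since `f` and `-f` are not both in `D(x)`.) -/
def PropertyBD (X : Type*) [NormedAddCommGroup X] [NormedSpace ℝ X] : Prop :=
  ∀ x ∈ Metric.sphere (0 : X) 1,
    sSup ((fun f : StrongDual ℝ X => f x) ''
      (Set.extremePoints ℝ (Metric.closedBall (0 : StrongDual ℝ X) 1) \ dualFace x)) < 1

/-! The isometry with `ℓ₁` turns the norm of `X` into the supremum of `|e n v|` over the unit-vector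
functionals `e n`, and the extreme points of the dual ball are exactly `±e n`. The equivalence is
proved as a cycle.

(BD) gives polyhedrality: given the gap below 1 at `x`, an extreme point `y` of a finite-dimensional
ball close to `x` has `2y - x` in the ball, so `y = x`. Extreme points therefore cannot accumulate,
and Krein–Milman finishes. Polyhedrality excludes `c`: cosine and sine sampled along a null sequence
span a plane in `c` whose ball has infinitely many faces.

The main step builds `c` when (BD) fails at some `x`. After sign changes, basis functionals `e (m
k)` with values below 1 at `x` converge weak-* to some `f` in the dual ball with `f x = 1`. Let `B`
consist of the indices `m k` and of the contact set `e n x = 1`. Since `f` is supported on the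
contact set, the `e n` with `n ∈ B` lie in a weak-* compact convex set of functionals supported in
`B` (`detectsSupport_union_image`). A Hahn–Banach argument of Helly type
(`exists_forall_abs_sub_le`), made exact by completeness (`exists_eqOn_forall_norm_sub_le`), then
prescribes values on `B` together with finitely many norm bounds. It yields `u` equal to 1 on `B`
and `w k` equal on `B` to the indicator of `m k`, with every `u - 2 ∑ w k` in the ball. These behave
like the constant sequence 1 and the unit vectors of `c`. -/

/-! ### The `ℓ₁` basis of the dual and the extreme points of the dual ball. -/

/-- A family of functionals that behaves like the unit vector basis of `ℓ₁` in the dual space. -/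
structure DualL1Basis (X : Type*) [NormedAddCommGroup X] [NormedSpace ℝ X] where
  /-- the basis functionals -/
  e : ℕ → StrongDual ℝ X
  /-- the coordinates with respect to the basis -/
  coord : ℕ → StrongDual ℝ X →ₗ[ℝ] ℝ
  coord_e : ∀ n m, coord n (e m) = if n = m then 1 else 0
  hasSum_norm : ∀ g, HasSum (fun n => |coord n g|) ‖g‖
  hasSum : ∀ g, HasSum (fun n => coord n g • e n) g

theorem IsPredualL1.nonempty_basis {X : Type*} [NormedAddCommGroup X] [NormedSpace ℝ X]
    (hX : IsPredualL1 X) : Nonempty (DualL1Basis X) := by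
  obtain ⟨Φ⟩ := hX
  refine ⟨⟨fun n => Φ.symm (lp.single 1 n (1 : ℝ)),
    fun n => { toFun := fun g => Φ g n, map_add' := ?_, map_smul' := ?_ }, ?_, ?_, ?_⟩⟩
  · intro g h; simp
  · intro r g; simp
  · intro n m
    simp only [LinearMap.coe_mk, AddHom.coe_mk, LinearIsometryEquiv.apply_symm_apply]
    split_ifs with h
    · subst h; simp
    · exact lp.single_apply_ne _ _ _ h
  · intro g
    have := lp.hasSum_norm (p := 1) (by simp) (Φ g)
    simpa using this
  · intro g
    have := (lp.hasSum_single (p := 1) (by simp) (Φ g)).mapL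
      (Φ.symm.toContinuousLinearEquiv : lp (fun _ : ℕ => ℝ) 1 →L[ℝ] StrongDual ℝ X)
    convert! this using 1
    · funext n
      show Φ g n • Φ.symm (lp.single 1 n (1 : ℝ)) = Φ.symm (lp.single 1 n (Φ g n))
      rw [← map_smul, ← lp.single_smul, smul_eq_mul, mul_one]
    · exact (Φ.symm_apply_apply g).symm

namespace DualL1Basis

variable {X : Type*} [NormedAddCommGroup X] [NormedSpace ℝ X] (β : DualL1Basis X)

theorem abs_coord_le (n : ℕ) (g : StrongDual ℝ X) : |β.coord n g| ≤ ‖g‖ :=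
  le_hasSum (β.hasSum_norm g) n fun _ _ => abs_nonneg _

theorem norm_e (n : ℕ) : ‖β.e n‖ = 1 := by
  have h := β.hasSum_norm (β.e n)
  have h2 : HasSum (fun m => |β.coord m (β.e n)|) 1 := by
    convert hasSum_ite_eq n (1 : ℝ) using 2 with m
    rw [β.coord_e]; split_ifs <;> simp
  exact h.unique h2

theorem abs_e_le (n : ℕ) (v : X) : |β.e n v| ≤ ‖v‖ := by
  simpa [β.norm_e] using (β.e n).le_opNorm v

theorem hasSum_apply (g : StrongDual ℝ X) (v : X) :
    HasSum (fun n => β.coord n g * β.e n v) (g v) := by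
  simpa using (β.hasSum g).mapL (ContinuousLinearMap.apply ℝ ℝ v)

theorem apply_le_mul {g : StrongDual ℝ X} {v : X} {C : ℝ} {S : Set ℕ}
    (hg : ∀ n ∉ S, β.coord n g = 0) (h : ∀ n ∈ S, |β.e n v| ≤ C) : g v ≤ C * ‖g‖ := by
  refine hasSum_le (fun n => ?_) (β.hasSum_apply g v) ((β.hasSum_norm g).mul_left C)
  by_cases hn : n ∈ S
  · calc β.coord n g * β.e n v ≤ |β.coord n g * β.e n v| := le_abs_self _
      _ = |β.e n v| * |β.coord n g| := by rw [abs_mul, mul_comm]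
      _ ≤ _ := mul_le_mul_of_nonneg_right (h n hn) (abs_nonneg _)
  · simp [hg n hn]

theorem norm_le_of_forall {v : X} {C : ℝ} (h : ∀ n, |β.e n v| ≤ C) : ‖v‖ ≤ C := by
  have hC : 0 ≤ C := (abs_nonneg _).trans (h 0)
  obtain ⟨g, hg, hgv⟩ := exists_dual_vector'' ℝ v
  have h1 := β.apply_le_mul (g := g) (S := Set.univ) (by simp) (fun n _ => h n)
  rw [hgv] at h1
  simp only [RCLike.ofReal_real_eq_id, id_eq] at h1
  nlinarith

theorem ext_coord {g h : StrongDual ℝ X} (H : ∀ n, β.coord n g = β.coord n h) : g = h :=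
  (β.hasSum g).unique (by simpa [H] using β.hasSum h)

/-- The basis functionals multiplied by signs. -/
def signChange (σ : ℕ → ℝ) (hσ : ∀ n, |σ n| = 1) : DualL1Basis X where
  e n := σ n • β.e n
  coord n := σ n • β.coord n
  coord_e n m := by
    have : σ n * σ n = 1 := by rw [← abs_mul_abs_self, hσ]; norm_num
    by_cases h : n = m
    · subst h; simp [β.coord_e, this]
    · simp [β.coord_e, h]
  hasSum_norm g := by simpa [abs_mul, hσ] using β.hasSum_norm g
  hasSum g := by
    have h (n) : σ n * σ n = 1 := by rw [← abs_mul_abs_self, hσ]; norm_num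
    refine (β.hasSum g).congr_fun fun n => ?_
    simp only [LinearMap.smul_apply, smul_eq_mul, smul_smul]
    rw [show σ n * β.coord n g * σ n = (σ n * σ n) * β.coord n g by ring, h, one_mul]

/-- If `σ • e n` lies strictly between `g` and `h` in the ball, both must have `n`-th coordinate
`σ`; this exhausts the `ℓ₁` norm of `g`, so its other coordinates vanish. -/
theorem smul_e_mem_extremePoints {σ : ℝ} (hσ : |σ| = 1) (n : ℕ) :
    σ • β.e n ∈ Set.extremePoints ℝ (Metric.closedBall (0 : StrongDual ℝ X) 1) := by
  rw [mem_extremePoints_iff_left]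
  refine ⟨by simp [norm_smul, hσ, β.norm_e], ?_⟩
  rintro g hg h hh ⟨a, b, ha, hb, hab, hgh⟩
  have hσ2 : σ * σ = 1 := by rw [← abs_mul_abs_self, hσ]; norm_num
  rw [mem_closedBall_zero_iff] at hg hh
  have hn := congrArg (fun k => σ * β.coord n k) hgh
  simp only [map_add, map_smul, smul_eq_mul, β.coord_e, if_true, mul_one, hσ2] at hn
  have h1 : σ * β.coord n g ≤ 1 := (le_abs_self _).trans
    (by rw [abs_mul, hσ, one_mul]; exact (β.abs_coord_le n g).trans hg)
  have h2 : σ * β.coord n h ≤ 1 := (le_abs_self _).trans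
    (by rw [abs_mul, hσ, one_mul]; exact (β.abs_coord_le n h).trans hh)
  have h3 : σ * β.coord n g = 1 := by nlinarith
  have h4 : β.coord n g = σ := by linear_combination σ * h3 - β.coord n g * hσ2
  refine β.ext_coord fun m => ?_
  rw [map_smul, β.coord_e]
  by_cases hm : m = n
  · subst hm; simp [h4]
  · have := sum_le_hasSum {m, n} (fun _ _ => abs_nonneg _) (β.hasSum_norm g)
    rw [Finset.sum_pair hm, h4, hσ] at this
    have : |β.coord m g| ≤ 0 := by linarith
    simpa [hm] using this

/-- A functional with a nonzero coordinate `t`, `|t| < 1`, is a convex combination of a signed `e n`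
and its rescaled remainder, because the `ℓ₁` norm is additive over disjoint supports. Extremality
identifies it with the former. -/
theorem exists_eq_smul_e {g : StrongDual ℝ X}
    (hg : g ∈ Set.extremePoints ℝ (Metric.closedBall (0 : StrongDual ℝ X) 1)) :
    ∃ n, ∃ σ : ℝ, |σ| = 1 ∧ g = σ • β.e n := by
  have hg1 := hg.1
  rw [mem_closedBall_zero_iff] at hg1
  obtain ⟨n, hn⟩ : ∃ n, β.coord n g ≠ 0 := by
    by_contra! hcon
    have h0 : g = 0 := β.ext_coord fun n => by simp [hcon]
    subst h0
    have := hg.2 (x₁ := β.e 0) (by simp [β.norm_e]) (x₂ := -β.e 0) (by simp [β.norm_e])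
      ⟨1/2, 1/2, by norm_num, by norm_num, by norm_num, by simp⟩
    have h1 := β.norm_e 0
    rw [this] at h1
    simp at h1
  set t := β.coord n g with ht
  have htpos : 0 < |t| := abs_pos.2 hn
  set σ : ℝ := t / |t| with hσ
  have hσ1 : |σ| = 1 := by rw [hσ, abs_div, abs_abs, div_self htpos.ne']
  have hts : |t| * σ = t := by rw [hσ]; field_simp
  have hrest : ‖g - t • β.e n‖ ≤ 1 - |t| := by
    refine hasSum_le_of_sum_le (β.hasSum_norm _) fun s => ?_
    have hle := sum_le_hasSum (insert n s) (fun _ _ => abs_nonneg _) (β.hasSum_norm g)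
    rw [← Finset.add_sum_erase _ _ (Finset.mem_insert_self n s)] at hle
    have : ∑ m ∈ s, |β.coord m (g - t • β.e n)|
        ≤ ∑ m ∈ (insert n s).erase n, |β.coord m g| := by
      rw [Finset.erase_insert_eq_erase]
      have h0 : |β.coord n (g - t • β.e n)| = 0 := by simp [β.coord_e, ← ht]
      rw [← Finset.sum_erase s h0]
      refine Finset.sum_le_sum fun m hm => ?_
      simp [β.coord_e, Finset.ne_of_mem_erase hm]
    linarith
  refine ⟨n, σ, hσ1, ?_⟩
  have ht1 : |t| ≤ 1 := (β.abs_coord_le n g).trans hg1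
  rcases ht1.lt_or_eq with h1 | h1
  · have hpos : 0 < 1 - |t| := by linarith
    refine (hg.2 (x₁ := σ • β.e n) (by simp [norm_smul, hσ1, β.norm_e])
      (x₂ := (1 - |t|)⁻¹ • (g - t • β.e n)) ?_
      ⟨|t|, 1 - |t|, htpos, hpos, by ring, ?_⟩).symm
    · rw [mem_closedBall_zero_iff, norm_smul, norm_inv, Real.norm_of_nonneg hpos.le,
        inv_mul_le_iff₀ hpos]
      linarith
    · rw [smul_smul, smul_smul, hts, mul_inv_cancel₀ hpos.ne', one_smul]; abel
  · rw [h1, sub_self] at hrest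
    have h2 : g - t • β.e n = 0 := norm_le_zero_iff.1 hrest
    rw [h1, one_mul] at hts
    rw [hts]; exact sub_eq_zero.1 h2

end DualL1Basis

/-! ### (BD) implies polyhedrality. -/

theorem PropertyBD.isPolyhedral {X : Type*} [NormedAddCommGroup X] [NormedSpace ℝ X]
    (β : DualL1Basis X) (h : PropertyBD X) : IsPolyhedral X := by
  intro F hF
  have hproper : ProperSpace F := FiniteDimensional.proper_real F
  set K := Metric.closedBall (0 : F) 1 with hK
  have hKc : IsCompact K := isCompact_closedBall _ _
  have key : ∀ x : F, ‖x‖ = 1 → ∃ η > 0, ∀ y ∈ K.extremePoints ℝ, ‖y - x‖ < η → y = x := by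
    intro x hx
    have hBD := h (x : X) (by simpa using hx)
    set r := sSup ((fun f : StrongDual ℝ X => f x) ''
      (Set.extremePoints ℝ (Metric.closedBall (0 : StrongDual ℝ X) 1) \ dualFace (x : X))) with hr
    -- This radius makes `g (2y - x) = g x + 2 g (y - x)` at most `r + (1 - r) = 1` off `D(x)`; on
    -- `D(x)` the value is `2 g y - 1 ≤ 1` anyway.
    refine ⟨(1 - r) / 2, by linarith, fun y hy hyx => ?_⟩
    have hval : ∀ g ∈ Set.extremePoints ℝ (Metric.closedBall (0 : StrongDual ℝ X) 1),
        g ((2 : ℝ) • (y : X) - x) ≤ 1 := by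
      intro g hg
      have hg1 : ‖g‖ ≤ 1 := by simpa using hg.1
      have hb : ∀ v : X, g v ≤ ‖v‖ := fun v => (le_abs_self _).trans
        ((g.le_opNorm v).trans (mul_le_of_le_one_left (norm_nonneg _) hg1))
      by_cases hgD : g ∈ dualFace (x : X)
      · have h1 := hb y
        have h2 : ‖(y : X)‖ ≤ 1 := by simpa [hK] using hy.1
        have h3 := hgD.2
        simp only [map_sub, map_smul, smul_eq_mul]
        linarith
      · have h1 : g x ≤ r := by
          refine le_csSup ⟨1, ?_⟩ ⟨g, ⟨hg, hgD⟩, rfl⟩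
          rintro _ ⟨k, hk, rfl⟩
          have hk1 : ‖k‖ ≤ 1 := by simpa using hk.1.1
          have := (le_abs_self _).trans (k.le_opNorm (x : X))
          have hx' : ‖(x : X)‖ = 1 := hx
          rw [hx', mul_one] at this
          exact this.trans hk1
        have h2 := hb ((y : X) - x)
        have h3 : ‖(y : X) - x‖ < (1 - r) / 2 := hyx
        simp only [map_sub, map_smul, smul_eq_mul] at h2 ⊢
        linarith
    have hmem : (2 : ℝ) • y - x ∈ K := by
      rw [hK, mem_closedBall_zero_iff]
      refine β.norm_le_of_forall (v := (2 : ℝ) • (y : X) - x) fun n => abs_le.2 ⟨?_, ?_⟩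
      · have := hval _ (β.smul_e_mem_extremePoints (σ := -1) (by simp) n)
        simp only [smul_apply, smul_eq_mul] at this
        linarith
      · simpa using hval _ (β.smul_e_mem_extremePoints (σ := 1) (by simp) n)
    refine (hy.2 (x₁ := x) (by simp [hK, hx]) hmem
      ⟨1/2, 1/2, by norm_num, by norm_num, by norm_num, ?_⟩).symm
    module
  have hfin : (K.extremePoints ℝ).Finite := by
    by_contra hinf
    -- The origin is extreme only when `F` is trivial; without it the extreme points lie on the
    -- compact unit sphere.
    have hinf2 : (K.extremePoints ℝ \ {0}).Infinite := Set.Infinite.sdiff hinf (Set.finite_singleton 0)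
    have hsub : K.extremePoints ℝ \ {0} ⊆ Metric.sphere (0 : F) 1 := by
      rintro y ⟨hy, hy0⟩
      rw [mem_sphere_zero_iff_norm]
      have hy1 : ‖y‖ ≤ 1 := by simpa [hK] using hy.1
      have hypos : 0 < ‖y‖ := norm_pos_iff.2 hy0
      by_contra hne
      have hlt : ‖y‖ < 1 := lt_of_le_of_ne hy1 hne
      refine hy0 (hy.2 (x₁ := 0) (by simp [hK]) (x₂ := ‖y‖⁻¹ • y)
        (by rw [hK, mem_closedBall_zero_iff, norm_smul, norm_inv, norm_norm, inv_mul_cancel₀ hypos.ne'])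
        ⟨1 - ‖y‖, ‖y‖, by linarith, hypos, by ring, ?_⟩).symm
      rw [smul_smul, mul_inv_cancel₀ hypos.ne']; simp
    obtain ⟨x, hxs, hacc⟩ := hinf2.exists_accPt_of_subset_isCompact (isCompact_sphere _ _) hsub
    obtain ⟨η, hη, hηx⟩ := key x (by simpa using hxs)
    obtain ⟨y, hy, hyx⟩ := accPt_iff_nhds.1 hacc _ (Metric.ball_mem_nhds x hη)
    exact hyx (hηx y hy.2.1 (by simpa [dist_eq_norm] using hy.1))
  refine ⟨_, hfin, ?_⟩
  exact (closure_convexHull_extremePoints hKc (convex_closedBall _ _)).symm.trans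
    (hfin.isCompact_convexHull ℝ).isClosed.closure_eq

/-! ### Polyhedral spaces contain no copy of `c`. -/

/-- Were the ball the hull of a finite `s`, `v n` would be a combination of the points of `s` where
`f n` is 1. These subsets of `s` differ for different `n`, since otherwise `f m (v n) = 1`; but `s`
has only finitely many subsets. -/
theorem not_isPolytope_closedBall_of_forall_lt {F : Type*} [NormedAddCommGroup F] [NormedSpace ℝ F]
    (v : ℕ → F) (f : ℕ → F →ₗ[ℝ] ℝ) (hv : ∀ n, ‖v n‖ ≤ 1) (hf : ∀ n x, ‖x‖ ≤ 1 → f n x ≤ 1)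
    (hfv : ∀ n, f n (v n) = 1) (hlt : ∀ n m, m ≠ n → f m (v n) < 1) :
    ¬ IsPolytope (Metric.closedBall (0 : F) 1) := by
  rintro ⟨s, hs, hball⟩
  have hs1 : ∀ p ∈ s, ‖p‖ ≤ 1 := fun p hp => by
    have : p ∈ Metric.closedBall (0 : F) 1 := hball ▸ subset_convexHull ℝ s hp
    simpa using this
  have hinj : Function.Injective (fun n => {p ∈ s | f n p = 1}) := by
    intro n m hnm
    by_contra hne
    have hvn : v n ∈ convexHull ℝ s := hball ▸ (by simpa using hv n)
    rw [← hs.coe_toFinset, Finset.mem_convexHull'] at hvn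
    obtain ⟨w, hw0, hw1, hwv⟩ := hvn
    have hz : ∀ p ∈ hs.toFinset, w p * (1 - f n p) = 0 := by
      refine (Finset.sum_eq_zero_iff_of_nonneg fun p hp => mul_nonneg (hw0 p hp) ?_).1 ?_
      · have := hf n p (hs1 p (by simpa using hp)); linarith
      · have := hfv n
        rw [← hwv] at this
        simp only [map_sum, map_smul, smul_eq_mul] at this
        simp only [mul_sub, mul_one, Finset.sum_sub_distrib, hw1, this, sub_self]
    have : f m (v n) = 1 := by
      rw [← hwv, ← hw1]
      simp only [map_sum, map_smul, smul_eq_mul]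
      refine Finset.sum_congr rfl fun p hp => ?_
      rcases mul_eq_zero.1 (hz p hp) with h0 | h0
      · simp [h0]
      · have hp' : p ∈ {p ∈ s | f n p = 1} := ⟨by simpa using hp, by linarith⟩
        have hnm' : {p ∈ s | f n p = 1} = {p ∈ s | f m p = 1} := hnm
        rw [hnm'] at hp'
        rw [hp'.2, mul_one]
    exact (hlt n m (Ne.symm hne)).ne this
  exact Set.infinite_of_injective_forall_mem hinj (fun n => Set.sep_subset s _) hs.finite_subsets

theorem IsPolyhedral.not_containsIsometricCopyOfC {X : Type*} [NormedAddCommGroup X]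
    [NormedSpace ℝ X] (h : IsPolyhedral X) : ¬ ContainsIsometricCopyOfC X := by
  rintro ⟨T⟩
  let θ : ℕ → ℝ := fun n => 1 / ((n : ℝ) + 1)
  have hθ : Filter.Tendsto θ Filter.atTop (nhds 0) := tendsto_one_div_add_atTop_nhds_zero_nat
  have hθ0 : ∀ n, 0 < θ n := fun n => by positivity
  have hθ1 : ∀ n, θ n ≤ 1 := fun n => by
    simp only [θ]; rw [div_le_one (by positivity)]; linarith [n.cast_nonneg (α := ℝ)]
  have hθinj : ∀ n m, m ≠ n → θ m - θ n ≠ 0 := by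
    intro n m hmn h0
    refine hmn ?_
    have := sub_eq_zero.1 h0
    simpa [θ] using this
  let mk : (ψ : ℝ → ℝ) → Continuous ψ → (∀ t, |ψ t| ≤ 1) → ConvergentSeq := fun ψ hc hb =>
    ⟨⟨fun n => ψ (θ n), memℓp_infty ⟨1, by rintro _ ⟨n, rfl⟩; exact hb _⟩⟩,
      ψ 0, (hc.tendsto 0).comp hθ⟩
  let x := mk Real.cos Real.continuous_cos Real.abs_cos_le_one
  let y := mk Real.sin Real.continuous_sin Real.abs_sin_le_one
  let w : ℕ → ConvergentSeq := fun n => Real.cos (θ n) • x + Real.sin (θ n) • y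
  -- By the addition formula, `w n` attains the value 1 only at coordinate `n`, so the coordinate
  -- functionals expose infinitely many faces.
  have hw : ∀ n m, (w n : lp (fun _ : ℕ => ℝ) ∞) m = Real.cos (θ m - θ n) := by
    intro n m
    rw [Real.cos_sub]
    show Real.cos (θ n) * Real.cos (θ m) + Real.sin (θ n) * Real.sin (θ m) = _
    ring
  let ev : ℕ → ConvergentSeq →L[ℝ] ℝ := fun n =>
    LinearMap.mkContinuous
      { toFun := fun z => (z : lp (fun _ : ℕ => ℝ) ∞) n
        map_add' := fun _ _ => rfl
        map_smul' := fun _ _ => rfl } 1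
      (fun z => by
        rw [one_mul]
        exact lp.norm_apply_le_norm (by simp) (z : lp (fun _ : ℕ => ℝ) ∞) n)
  have hev : ∀ n, ‖ev n‖ ≤ 1 := fun n => LinearMap.mkContinuous_norm_le _ zero_le_one _
  have hext : ∀ n, ∃ g : StrongDual ℝ X, ‖g‖ ≤ 1 ∧ ∀ z, g (T z) = ev n z := by
    intro n
    let S := T.equivRange
    obtain ⟨g, hg, hgn⟩ := exists_extension_norm_eq (LinearMap.range T.toLinearMap)
      ((ev n).comp (S.symm.toContinuousLinearEquiv : _ →L[ℝ] ConvergentSeq))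
    refine ⟨g, ?_, fun z => ?_⟩
    · rw [hgn]
      refine ContinuousLinearMap.opNorm_le_bound _ zero_le_one fun v => ?_
      refine ((ev n).le_of_opNorm_le (hev n) (S.symm v)).trans ?_
      rw [S.symm.norm_map]
    · refine (hg (S z)).trans ?_
      show ev n (S.symm (S z)) = ev n z
      rw [S.symm_apply_apply]
  choose g hg1 hgT using hext
  let F : Submodule ℝ X := Submodule.span ℝ {T x, T y}
  have hF : FiniteDimensional ℝ F := FiniteDimensional.span_of_finite ℝ (by simp)
  have hmem : ∀ n, T (w n) ∈ F := fun n => by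
    simp only [w, map_add, map_smul]
    exact F.add_mem (F.smul_mem _ (Submodule.subset_span (by simp)))
      (F.smul_mem _ (Submodule.subset_span (by simp)))
  refine not_isPolytope_closedBall_of_forall_lt (F := F) (fun n => ⟨T (w n), hmem n⟩)
    (fun n => (g n).toLinearMap.comp F.subtype) ?_ ?_ ?_ ?_ (h F hF)
  · intro n
    show ‖T (w n)‖ ≤ 1
    rw [T.norm_map]
    refine lp.norm_le_of_forall_le (f := (w n : lp (fun _ : ℕ => ℝ) ∞)) zero_le_one fun m => ?_
    rw [hw]; exact Real.abs_cos_le_one _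
  · intro n z hz
    refine (le_abs_self _).trans (((g n).le_opNorm (z : X)).trans ?_)
    exact mul_le_one₀ (hg1 n) (norm_nonneg _) hz
  · intro n
    show g n (T (w n)) = 1
    rw [hgT]
    show (w n : lp (fun _ : ℕ => ℝ) ∞) n = 1
    rw [hw]; simp
  · intro n m hmn
    show g m (T (w n)) < 1
    rw [hgT]
    show (w n : lp (fun _ : ℕ => ℝ) ∞) m < 1
    rw [hw]
    -- The angles lie in `(0, 1]`, so their differences lie strictly between `-2π` and `2π`, where
    -- cosine equals 1 only at 0.
    refine lt_of_le_of_ne (Real.cos_le_one _) fun h1 => hθinj n m hmn ?_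
    have h2 := hθ0 n
    have h3 := hθ0 m
    have h4 := hθ1 n
    have h5 := hθ1 m
    have h6 := Real.pi_gt_three
    exact (Real.cos_eq_one_iff_of_lt_of_lt (by linarith) (by linarith)).1 h1

/-! ### Helly type interpolation on sets that detect supports. -/

namespace DualL1Basis

variable {X : Type*} [NormedAddCommGroup X] [NormedSpace ℝ X] (β : DualL1Basis X)

/-- The seminorm `v ↦ sup_{n ∈ B} |e n v|` only dominates functionals supported in `B`. -/
def DetectsSupport (B : Set ℕ) : Prop :=
  ∀ b : StrongDual ℝ X, (∃ M, ∀ v, (∀ n ∈ B, |β.e n v| ≤ 1) → b v ≤ M) →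
    ∀ n ∉ B, β.coord n b = 0

theorem detectsSupport_univ : β.DetectsSupport Set.univ :=
  fun _ _ n hn => (hn (Set.mem_univ n)).elim

theorem summable_coord_mul (b : StrongDual ℝ X) {s : ℕ → ℝ} {M : ℝ} (hM : ∀ n, |s n| ≤ M) :
    Summable fun n => β.coord n b * s n := by
  refine Summable.of_norm_bounded ((β.hasSum_norm b).summable.mul_left M) fun n => ?_
  rw [norm_mul, mul_comm]
  exact mul_le_mul_of_nonneg_right (hM n) (abs_nonneg _)

end DualL1Basis

/-- The norm of `b` need not be attained; the gap between `ρ` and `r` compensates for this. -/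
theorem ContinuousLinearMap.exists_norm_lt_mul_opNorm_le {X : Type*} [NormedAddCommGroup X]
    [NormedSpace ℝ X] (b : StrongDual ℝ X) {ρ r : ℝ} (hρ : 0 ≤ ρ) (hr : ρ < r) :
    ∃ w, ‖w‖ < r ∧ ρ * ‖b‖ ≤ b w := by
  have hrpos : 0 < r := hρ.trans_lt hr
  rcases (norm_nonneg b).eq_or_lt with h0 | h0
  · exact ⟨0, by simpa using hrpos, by simp [← h0]⟩
  · obtain ⟨v, hv, hbv⟩ := b.exists_lt_apply_of_lt_opNorm (r := ρ / r * ‖b‖)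
      (mul_lt_of_lt_one_left h0 ((div_lt_one hrpos).2 hr))
    have h1 : ρ * ‖b‖ < r * |b v| := by
      have := mul_lt_mul_of_pos_left hbv hrpos
      rwa [← mul_assoc, mul_div_cancel₀ _ hrpos.ne'] at this
    rcases le_total 0 (b v) with hs | hs
    · refine ⟨r • v, ?_, ?_⟩
      · rw [norm_smul, Real.norm_of_nonneg hrpos.le]; exact mul_lt_of_lt_one_right hrpos hv
      · rw [abs_of_nonneg hs] at h1; simpa using h1.le
    · refine ⟨-(r • v), ?_, ?_⟩
      · rw [norm_neg, norm_smul, Real.norm_of_nonneg hrpos.le]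
        exact mul_lt_of_lt_one_right hrpos hv
      · rw [abs_of_nonpos hs] at h1; simp; linarith

namespace DualL1Basis

variable {X : Type*} [NormedAddCommGroup X] [NormedSpace ℝ X] (β : DualL1Basis X)

open scoped Pointwise in
/-- A Helly type theorem: a finite system of inequalities `|e n z - e n (c i)| ≤ ρ i`, `n ∈ N i`,
which is solved by a bounded sequence, is approximately solved by a vector. -/
theorem exists_forall_abs_sub_le {ι : Type*} [Finite ι] {N : ι → Set ℕ} {c : ι → X} {ρ : ι → ℝ}
    (hN : ∀ i, β.DetectsSupport (N i)) (hρ : ∀ i, 0 ≤ ρ i) {s : ℕ → ℝ} {M : ℝ}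
    (hM : ∀ n, |s n| ≤ M) (hs : ∀ i, ∀ n ∈ N i, |s n - β.e n (c i)| ≤ ρ i)
    {ε : ℝ} (hε : 0 < ε) :
    ∃ z : X, ∀ i, ∀ n ∈ N i, |β.e n z - β.e n (c i)| ≤ ρ i + ε := by
  classical
  have := Fintype.ofFinite ι
  have hε2 : 0 < ε / 2 := by linarith
  let W : ι → Set X := fun i => {v | ∀ n ∈ N i, |β.e n v| ≤ ε / 2}
  let O : ι → Set X := fun i => Metric.ball (c i) (ρ i + ε / 2) + W i
  have hW0 : ∀ i, (0 : X) ∈ W i := fun i n _ => by simp [hε2.le]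
  have hWconv : ∀ i, Convex ℝ (W i) := by
    intro i v hv w hw a b ha hb hab n hn
    rw [map_add, map_smul, map_smul, smul_eq_mul, smul_eq_mul]
    calc |a * β.e n v + b * β.e n w| ≤ |a * β.e n v| + |b * β.e n w| := abs_add_le _ _
      _ = a * |β.e n v| + b * |β.e n w| := by
        rw [abs_mul, abs_mul, abs_of_nonneg ha, abs_of_nonneg hb]
      _ ≤ a * (ε / 2) + b * (ε / 2) := by
        gcongr
        · exact hv n hn
        · exact hw n hn
      _ = ε / 2 := by rw [← add_mul, hab, one_mul]
  have hOopen : IsOpen (Set.univ.pi O) :=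
    isOpen_set_pi Set.finite_univ fun i _ => Metric.isOpen_ball.add_right
  have hOconv : Convex ℝ (Set.univ.pi O) :=
    convex_pi fun i _ => (convex_ball _ _).add (hWconv i)
  have hballO : ∀ i y, ‖y‖ < ρ i + ε / 2 → c i + y ∈ O i := fun i y hy =>
    ⟨c i + y, by simpa using hy, 0, hW0 i, add_zero _⟩
  let D : Submodule ℝ (ι → X) := LinearMap.range (LinearMap.pi fun _ : ι => LinearMap.id)
  -- A common point of all `O i` is a point of the diagonal `D` in their product. If there is none,
  -- a separating functional splits into `b i` with sum zero, each supported in `N i`. Pairing `s`,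
  -- an element of the bidual, with the `b i` gives total 0, while the bounds on `N i` make this
  -- total at most a number below `u ≤ 0`.
  by_cases hdisj : Disjoint (Set.univ.pi O) (D : Set (ι → X))
  · exfalso
    obtain ⟨f, u, hfO, hfD⟩ := geometric_hahn_banach_open hOconv hOopen D.convex hdisj
    have hu : u ≤ 0 := by simpa using hfD 0 D.zero_mem
    have hfD0 : ∀ y ∈ D, f y = 0 := by
      intro y hy
      by_contra hne
      have := hfD (((u - 1) / f y) • y) (D.smul_mem _ hy)
      rw [map_smul, smul_eq_mul, div_mul_cancel₀ _ hne] at this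
      linarith
    let b : ι → StrongDual ℝ X := fun i => f.comp (ContinuousLinearMap.single ℝ (fun _ => X) i)
    have hfb : ∀ y, f y = ∑ i, b i (y i) := by
      intro y
      conv_lhs => rw [← Finset.univ_sum_single y]
      rw [map_sum]
      rfl
    have hbsum : ∑ i, b i = 0 := by
      ext v
      have := hfD0 (fun _ => v) ⟨v, rfl⟩
      rw [hfb] at this
      simpa using this
    have hsupp : ∀ i, ∀ n ∉ N i, β.coord n (b i) = 0 := by
      intro i
      refine hN i (b i) ⟨-f c / (ε / 2), fun v hv => ?_⟩
      have hmem : c + Pi.single i ((ε / 2) • v) ∈ Set.univ.pi O := by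
        intro j _
        by_cases hj : j = i
        · subst hj
          refine ⟨c j, Metric.mem_ball_self (by linarith [hρ j]), (ε / 2) • v, fun n hn => ?_,
            by simp⟩
          rw [map_smul, smul_eq_mul, abs_mul, abs_of_pos hε2]
          exact mul_le_of_le_one_right hε2.le (hv n hn)
        · simpa [hj] using hballO j 0 (by simpa using (by linarith [hρ j] : 0 < ρ j + ε / 2))
      have h1 := hfO _ hmem
      have h2 : f (Pi.single i ((ε / 2) • v)) = (ε / 2) * b i v := by
        rw [← smul_eq_mul, ← map_smul]; rfl
      rw [map_add, h2] at h1
      rw [le_div_iff₀ hε2]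
      linarith
    choose w hw hbw using fun i => (b i).exists_norm_lt_mul_opNorm_le (hρ i)
      (by linarith : ρ i < ρ i + ε / 2)
    have hlt : f (fun i => c i + w i) < u := hfO _ fun i _ => hballO i _ (hw i)
    rw [hfb] at hlt
    have hcoord : ∀ i, HasSum (fun n => β.coord n (b i) * s n) (∑' n, β.coord n (b i) * s n) :=
      fun i => (β.summable_coord_mul (b i) hM).hasSum
    have hL0 : ∑ i, ∑' n, β.coord n (b i) * s n = 0 := by
      refine (hasSum_sum fun i _ => hcoord i).unique ?_
      convert hasSum_zero with n
      rw [← Finset.sum_mul, ← map_sum, hbsum, map_zero, zero_mul]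
    have hle : ∀ i, ∑' n, β.coord n (b i) * s n ≤ b i (c i + w i) := by
      intro i
      have h1 : ∑' n, β.coord n (b i) * s n - b i (c i) ≤ ρ i * ‖b i‖ := by
        refine hasSum_le (fun n => ?_) ((hcoord i).sub (β.hasSum_apply (b i) (c i)))
          ((β.hasSum_norm (b i)).mul_left (ρ i))
        by_cases hn : n ∈ N i
        · calc _ = β.coord n (b i) * (s n - β.e n (c i)) := by ring
            _ ≤ |β.coord n (b i) * (s n - β.e n (c i))| := le_abs_self _
            _ = |s n - β.e n (c i)| * |β.coord n (b i)| := by rw [abs_mul, mul_comm]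
            _ ≤ _ := mul_le_mul_of_nonneg_right (hs i n hn) (abs_nonneg _)
        · simp [hsupp i n hn]
      rw [map_add]
      linarith [hbw i]
    have := Finset.sum_le_sum fun i (_ : i ∈ Finset.univ) => hle i
    linarith
  · obtain ⟨y, hyO, z, hz⟩ := Set.not_disjoint_iff.1 hdisj
    refine ⟨z, fun i n hn => ?_⟩
    obtain ⟨a, ha, v, hv, hav⟩ := hyO i (Set.mem_univ i)
    have hz' : z = a + v := (congrFun hz i).trans hav.symm
    have h1 := β.abs_e_le n (a - c i)
    rw [Metric.mem_ball, dist_eq_norm] at ha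
    have h2 := hv n hn
    rw [map_sub] at h1
    calc |β.e n z - β.e n (c i)| = |(β.e n a - β.e n (c i)) + β.e n v| := by
          rw [hz', map_add]; ring_nf
      _ ≤ |β.e n a - β.e n (c i)| + |β.e n v| := abs_add_le _ _
      _ ≤ ρ i + ε := by linarith

/-- One step of an iteration: the error is halved by a move of size proportional to it, so that the
iterates form a Cauchy sequence. -/
theorem exists_closer_approx {B : Set ℕ} (hB : β.DetectsSupport B) {C : Finset X} {s : ℕ → ℝ}
    (hC : ∀ c ∈ C, ∀ n, |s n - β.e n c| ≤ 1)
    (hs : ∀ ε > 0, ∃ p : X, ∀ n ∈ B, |β.e n p - s n| ≤ ε) {ε : ℝ} (hε : 0 < ε) {z : X}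
    (hzB : ∀ n ∈ B, |β.e n z - s n| ≤ ε) (hzC : ∀ c ∈ C, ‖z - c‖ ≤ 1 + ε) :
    ∃ z' : X, (∀ n ∈ B, |β.e n z' - s n| ≤ ε / 2) ∧ (∀ c ∈ C, ‖z' - c‖ ≤ 1 + ε / 2) ∧
      ‖z' - z‖ ≤ 2 * ε := by
  obtain ⟨p, hp⟩ := hs (ε / 6) (by linarith)
  -- Truncating `s` to within `ε` of `z` keeps the correction small. It changes nothing on `B`,
  -- where `z` is already `ε`-close, and preserves the distance bound 1 to every `c`.
  let s' : ℕ → ℝ := fun n => max (β.e n z - ε) (min (s n) (β.e n z + ε))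
  have hs'z : ∀ n, |s' n - β.e n z| ≤ ε := fun n => by
    rw [abs_le]
    refine ⟨?_, ?_⟩
    · have := le_max_left (β.e n z - ε) (min (s n) (β.e n z + ε)); simp only [s']; linarith
    · have : s' n ≤ β.e n z + ε := max_le (by linarith) (min_le_right _ _)
      linarith
  have hs'B : ∀ n ∈ B, s' n = s n := fun n hn => by
    have := abs_le.1 (hzB n hn)
    simp only [s']
    rw [min_eq_left (by linarith), max_eq_right (by linarith)]
  have hs'C : ∀ c ∈ C, ∀ n, |s' n - β.e n c| ≤ 1 := fun c hc n => by
    have h1 := abs_le.1 (hC c hc n)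
    have h2 := (β.abs_e_le n (z - c)).trans (hzC c hc)
    rw [map_sub, abs_le] at h2
    have h3 : s' n ≤ β.e n c + 1 := max_le (by linarith) ((min_le_left _ _).trans (by linarith))
    have h4 : β.e n c - 1 ≤ s' n :=
      (le_min (by linarith) (by linarith)).trans (le_max_right _ _)
    rw [abs_le]; constructor <;> linarith
  have hM : ∀ n, |s' n| ≤ ε + ‖z‖ := fun n => by
    have h1 := hs'z n
    have h2 := β.abs_e_le n z
    calc |s' n| = |(s' n - β.e n z) + β.e n z| := by ring_nf
      _ ≤ _ := (abs_add_le _ _).trans (by linarith)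
  obtain ⟨z', hz'⟩ := β.exists_forall_abs_sub_le (ι := C ⊕ Bool)
    (N := Sum.elim (fun _ => Set.univ) (fun t => bif t then Set.univ else B))
    (c := Sum.elim (fun c => c) (fun t => bif t then z else p))
    (ρ := Sum.elim (fun _ => 1) (fun t => bif t then ε else ε / 6))
    (s := s') (M := ε + ‖z‖) (ε := ε / 6)
    (by rintro (c | _ | _) <;> simp [hB, β.detectsSupport_univ])
    (by rintro (c | _ | _) <;> simp <;> linarith) hM
    (by
      rintro (c | _ | _) n hn
      · exact hs'C c c.2 n
      · have hn' : n ∈ B := hn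
        have := hp n hn'
        rw [abs_sub_comm] at this
        rw [hs'B n hn']
        exact this
      · exact hs'z n) (by linarith)
  refine ⟨z', fun n hn => ?_, fun c hc => ?_, ?_⟩
  · have h1 : |β.e n z' - β.e n p| ≤ ε / 6 + ε / 6 := hz' (Sum.inr false) n hn
    have h2 := hp n hn
    calc |β.e n z' - s n| ≤ |β.e n z' - β.e n p| + |β.e n p - s n| := abs_sub_le _ _ _
      _ ≤ ε / 2 := by linarith
  · refine β.norm_le_of_forall fun n => ?_
    have : |β.e n z' - β.e n c| ≤ 1 + ε / 6 := hz' (Sum.inl ⟨c, hc⟩) n (Set.mem_univ n)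
    rw [map_sub]; linarith
  · refine β.norm_le_of_forall fun n => ?_
    have : |β.e n z' - β.e n z| ≤ ε + ε / 6 := hz' (Sum.inr true) n (Set.mem_univ n)
    rw [map_sub]; linarith

/-- An extension theorem: data on `B` that are uniformly approximable by vectors are attained by a
vector in a given finite intersection of unit balls, as soon as this is possible for bounded
sequences. -/
theorem exists_eqOn_forall_norm_sub_le [CompleteSpace X] {B : Set ℕ} (hB : β.DetectsSupport B)
    {C : Finset X} {s : ℕ → ℝ} {M : ℝ} (hM : ∀ n, |s n| ≤ M)
    (hC : ∀ c ∈ C, ∀ n, |s n - β.e n c| ≤ 1)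
    (hs : ∀ ε > 0, ∃ p : X, ∀ n ∈ B, |β.e n p - s n| ≤ ε) :
    ∃ z : X, (∀ n ∈ B, β.e n z = s n) ∧ ∀ c ∈ C, ‖z - c‖ ≤ 1 := by
  -- The starting error is `1 = (1/2)^0`, matching the geometric errors of the iteration below.
  obtain ⟨z₀, hz₀B, hz₀C⟩ : ∃ z : X, (∀ n ∈ B, |β.e n z - s n| ≤ 1) ∧
      ∀ c ∈ C, ‖z - c‖ ≤ 1 + 1 := by
    obtain ⟨p, hp⟩ := hs (1 / 4) (by norm_num)
    obtain ⟨z, hz⟩ := β.exists_forall_abs_sub_le (ι := Option C)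
      (N := fun i => i.elim B fun _ => Set.univ) (c := fun i => i.elim p fun c => c)
      (ρ := fun i => i.elim (1 / 4) fun _ => 1) (s := s) (M := M) (ε := 1 / 4)
      (by rintro (_ | c) <;> simp [hB, β.detectsSupport_univ])
      (by rintro (_ | c) <;> simp) hM
      (by
        rintro (_ | c) n hn
        · rw [abs_sub_comm]; exact hp n hn
        · exact hC c c.2 n) (by norm_num)
    refine ⟨z, fun n hn => ?_, fun c hc => β.norm_le_of_forall fun n => ?_⟩
    · have h1 : |β.e n z - β.e n p| ≤ 1 / 4 + 1 / 4 := hz none n hn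
      have h2 := hp n hn
      calc |β.e n z - s n| ≤ |β.e n z - β.e n p| + |β.e n p - s n| := abs_sub_le _ _ _
        _ ≤ 1 := by linarith
    · have : |β.e n z - β.e n c| ≤ 1 + 1 / 4 := hz (some ⟨c, hc⟩) n (Set.mem_univ n)
      rw [map_sub]; linarith
  choose! F hFB hFC hF using fun (ε : ℝ) (z : X) (h : 0 < ε ∧ (∀ n ∈ B, |β.e n z - s n| ≤ ε) ∧
    ∀ c ∈ C, ‖z - c‖ ≤ 1 + ε) => β.exists_closer_approx hB hC hs h.1 h.2.1 h.2.2
  let z : ℕ → X := fun k => Nat.rec z₀ (fun k y => F ((1 / 2) ^ k) y) k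
  have hz : ∀ k, (0 : ℝ) < (1 / 2) ^ k ∧ (∀ n ∈ B, |β.e n (z k) - s n| ≤ (1 / 2) ^ k) ∧
      ∀ c ∈ C, ‖z k - c‖ ≤ 1 + (1 / 2) ^ k := by
    intro k
    induction k with
    | zero => simpa [z] using ⟨hz₀B, hz₀C⟩
    | succ k ih =>
      refine ⟨by positivity, fun n hn => ?_, fun c hc => ?_⟩
      · rw [pow_succ, mul_one_div]; exact hFB _ _ ih n hn
      · rw [pow_succ, mul_one_div]; exact hFC _ _ ih c hc
  have hcauchy : CauchySeq z := by
    refine cauchySeq_of_le_geometric (1 / 2) 2 (by norm_num) fun k => ?_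
    rw [dist_comm, dist_eq_norm]
    exact hF _ _ (hz k)
  obtain ⟨y, hy⟩ := cauchySeq_tendsto_of_complete hcauchy
  have hpow : Filter.Tendsto (fun k : ℕ => ((1 : ℝ) / 2) ^ k) Filter.atTop (nhds 0) :=
    tendsto_pow_atTop_nhds_zero_of_lt_one (by norm_num) (by norm_num)
  refine ⟨y, fun n hn => ?_, fun c hc => ?_⟩
  · have h1 : Filter.Tendsto (fun k => |β.e n (z k) - s n|) Filter.atTop
        (nhds |β.e n y - s n|) := ((((β.e n).continuous.tendsto y).comp hy).sub_const _).abs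
    have := le_of_tendsto_of_tendsto' h1 hpow fun k => (hz k).2.1 n hn
    exact sub_eq_zero.1 (abs_nonpos_iff.1 this)
  · have h2 := hpow.const_add 1
    rw [add_zero] at h2
    exact le_of_tendsto_of_tendsto' (hy.sub_const c).norm h2 fun k => (hz k).2.2 c hc

end DualL1Basis

/-! ### Weak-* compact sets of `ℓ₁`-combinations. -/

/-- The closed unit ball of `ℓ₁` as a set of sequences. -/
def absSummableBall : Set (ℕ → ℝ) := {l | ∀ N, ∑ k ∈ Finset.range N, |l k| ≤ 1}

theorem isCompact_absSummableBall : IsCompact absSummableBall := by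
  refine (isCompact_univ_pi fun _ : ℕ => isCompact_Icc (a := (-1 : ℝ)) (b := 1)).of_isClosed_subset
    ?_ fun l hl k _ => ?_
  · simp only [absSummableBall, Set.ofPred_forall]
    exact isClosed_iInter fun N => isClosed_le (by fun_prop) continuous_const
  · exact abs_le.1 ((Finset.single_le_sum (f := fun k => |l k|) (fun _ _ => abs_nonneg _)
      (Finset.self_mem_range_succ k)).trans (hl (k + 1)))

theorem convex_absSummableBall : Convex ℝ absSummableBall := by
  intro l hl l' hl' a b ha hb hab N
  calc ∑ k ∈ Finset.range N, |(a • l + b • l') k|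
      ≤ ∑ k ∈ Finset.range N, (a * |l k| + b * |l' k|) := by
        refine Finset.sum_le_sum fun k _ => (abs_add_le _ _).trans_eq ?_
        simp [abs_mul, abs_of_nonneg ha, abs_of_nonneg hb]
    _ = a * ∑ k ∈ Finset.range N, |l k| + b * ∑ k ∈ Finset.range N, |l' k| := by
        rw [Finset.sum_add_distrib, Finset.mul_sum, Finset.mul_sum]
    _ ≤ a * 1 + b * 1 := by gcongr; exacts [hl N, hl' N]
    _ = 1 := by linarith

theorem summable_abs_of_mem_absSummableBall {l : ℕ → ℝ} (hl : l ∈ absSummableBall) :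
    Summable fun k => |l k| :=
  summable_of_sum_range_le (fun _ => abs_nonneg _) hl

theorem tsum_abs_le_of_mem_absSummableBall {l : ℕ → ℝ} (hl : l ∈ absSummableBall) :
    ∑' k, |l k| ≤ 1 :=
  Real.tsum_le_of_sum_range_le (fun _ => abs_nonneg _) hl

theorem single_mem_absSummableBall {r : ℝ} (hr : |r| ≤ 1) (k : ℕ) :
    Pi.single k r ∈ absSummableBall := by
  intro N
  refine (Finset.sum_le_sum (g := fun j => if k = j then |r| else 0) fun j _ => ?_).trans ?_
  · by_cases h : k = j
    · subst h; simp
    · simp [h]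
  · rw [Finset.sum_ite_eq]; split_ifs
    · exact hr
    · exact zero_le_one

/-- Partial sums are continuous for the product topology, and they converge uniformly on the ball
because tails are bounded by the supremum of `|a k|` over large `k`. -/
theorem continuousOn_tsum_mul_absSummableBall {a : ℕ → ℝ}
    (ha : Filter.Tendsto a Filter.atTop (nhds 0)) :
    ContinuousOn (fun l : ℕ → ℝ => ∑' k, l k * a k) absSummableBall := by
  obtain ⟨R, hR⟩ := ha.norm.bddAbove_range
  have hR' : ∀ k, |a k| ≤ R := fun k => hR ⟨k, rfl⟩
  have hsum : ∀ l ∈ absSummableBall, Summable fun k => l k * a k := fun l hl => by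
    refine Summable.of_norm_bounded ((summable_abs_of_mem_absSummableBall hl).mul_left R)
      fun k => ?_
    rw [norm_mul, mul_comm]
    exact mul_le_mul_of_nonneg_right (hR' k) (abs_nonneg _)
  have hunif : TendstoUniformlyOn (fun (N : ℕ) (l : ℕ → ℝ) => ∑ k ∈ Finset.range N, l k * a k)
      (fun l => ∑' k, l k * a k) Filter.atTop absSummableBall := by
    rw [Metric.tendstoUniformlyOn_iff]
    intro ε hε
    obtain ⟨N₀, hN₀⟩ := Metric.tendsto_atTop.1 ha (ε / 2) (by linarith)
    filter_upwards [Filter.eventually_ge_atTop N₀] with N hN l hl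
    have hs := hsum l hl
    rw [Real.dist_eq, ← hs.sum_add_tsum_nat_add N, add_sub_cancel_left]
    have hl1 := summable_abs_of_mem_absSummableBall hl
    have hb : ∀ k, ‖l (k + N) * a (k + N)‖ ≤ ε / 2 * |l (k + N)| := fun k => by
      rw [norm_mul, mul_comm]
      have := hN₀ (k + N) (by omega)
      rw [Real.dist_eq, sub_zero] at this
      exact mul_le_mul_of_nonneg_right this.le (abs_nonneg _)
    have h1 := tsum_of_norm_bounded (((summable_nat_add_iff N).2 hl1).mul_left (ε / 2)).hasSum hb
    rw [tsum_mul_left] at h1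
    have h2 : ∑' k, |l (k + N)| ≤ 1 := by
      have h3 := hl1.sum_add_tsum_nat_add N
      have h4 := tsum_abs_le_of_mem_absSummableBall hl
      have h5 : 0 ≤ ∑ k ∈ Finset.range N, |l k| := Finset.sum_nonneg fun _ _ => abs_nonneg _
      linarith
    rw [← Real.norm_eq_abs]
    nlinarith
  refine hunif.continuousOn (Filter.Frequently.of_forall fun N => Continuous.continuousOn ?_)
  fun_prop

section WeakStarNull

variable {X : Type*} [NormedAddCommGroup X] [NormedSpace ℝ X] {h : ℕ → StrongDual ℝ X} {R : ℝ}

/-- The set of all `ℓ₁`-combinations of a bounded sequence of functionals, with coefficients in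
the unit ball of `ℓ₁`. -/
noncomputable def absConvexSums (h : ℕ → StrongDual ℝ X) : Set (WeakDual ℝ X) :=
  (fun l : ℕ → ℝ => StrongDual.toWeakDual (∑' k, l k • h k)) '' absSummableBall

theorem summable_smul_of_mem_absSummableBall (hR : ∀ k, ‖h k‖ ≤ R) {l : ℕ → ℝ}
    (hl : l ∈ absSummableBall) : Summable fun k => l k • h k := by
  refine Summable.of_norm_bounded ((summable_abs_of_mem_absSummableBall hl).mul_right R)
    fun k => ?_
  rw [norm_smul]
  exact mul_le_mul_of_nonneg_left (hR k) (abs_nonneg _)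

theorem isCompact_absConvexSums (hR : ∀ k, ‖h k‖ ≤ R)
    (h0 : ∀ v, Filter.Tendsto (fun k => h k v) Filter.atTop (nhds 0)) :
    IsCompact (absConvexSums h) := by
  refine isCompact_absSummableBall.image_of_continuousOn ?_
  rw [continuousOn_iff_continuous_domRestrict]
  refine WeakDual.continuous_of_continuous_eval fun v => ?_
  have := continuousOn_iff_continuous_domRestrict.1 (continuousOn_tsum_mul_absSummableBall (h0 v))
  convert this using 2 with l
  have hsum := (summable_smul_of_mem_absSummableBall hR l.2).hasSum.mapL
    (ContinuousLinearMap.apply ℝ ℝ v)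
  exact hsum.tsum_eq.symm

theorem convex_absConvexSums (hR : ∀ k, ‖h k‖ ≤ R) : Convex ℝ (absConvexSums h) := by
  rintro _ ⟨l, hl, rfl⟩ _ ⟨l', hl', rfl⟩ a b ha hb hab
  refine ⟨a • l + b • l', convex_absSummableBall hl hl' ha hb hab, ?_⟩
  have h1 := (summable_smul_of_mem_absSummableBall hR hl).hasSum.const_smul a
  have h2 := (summable_smul_of_mem_absSummableBall hR hl').hasSum.const_smul b
  have h3 := (h1.add h2).tsum_eq
  simp only [← map_smul, ← map_add, ← h3]
  congr 1
  refine tsum_congr fun k => ?_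
  simp [add_smul, smul_smul]

theorem smul_mem_absConvexSums (h : ℕ → StrongDual ℝ X) {r : ℝ} (hr : |r| ≤ 1) (k : ℕ) :
    StrongDual.toWeakDual (r • h k) ∈ absConvexSums h := by
  refine ⟨Pi.single k r, single_mem_absSummableBall hr k, ?_⟩
  simp only
  rw [tsum_eq_single k fun j hj => by simp [hj]]
  simp

end WeakStarNull

/-! ### Sets that detect supports. -/

namespace DualL1Basis

variable {X : Type*} [NormedAddCommGroup X] [NormedSpace ℝ X] (β : DualL1Basis X)

theorem coord_eq_zero_of_mem_absConvexSums {h : ℕ → StrongDual ℝ X} {R : ℝ}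
    (hR : ∀ k, ‖h k‖ ≤ R) {n : ℕ} (hn : ∀ k, β.coord n (h k) = 0) {g : WeakDual ℝ X}
    (hg : g ∈ absConvexSums h) : β.coord n (WeakDual.toStrongDual g) = 0 := by
  obtain ⟨l, hl, rfl⟩ := hg
  let φ : StrongDual ℝ X →L[ℝ] ℝ := (β.coord n).mkContinuous 1 fun g => by
    rw [one_mul]; exact β.abs_coord_le n g
  have := (summable_smul_of_mem_absSummableBall hR hl).hasSum.mapL φ
  refine this.unique ?_
  convert hasSum_zero with k
  show β.coord n (l k • h k) = 0
  rw [map_smul, hn, smul_zero]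

/-- A set `B` detects supports if its basis functionals lie in a weak-* compact convex set of
functionals supported in `B`. -/
theorem detectsSupport_of_isCompact {B : Set ℕ} {K : Set (WeakDual ℝ X)} (hK : IsCompact K)
    (hKc : Convex ℝ K) (hK0 : 0 ∈ K)
    (hKe : ∀ n ∈ B, StrongDual.toWeakDual (β.e n) ∈ K ∧ StrongDual.toWeakDual (-β.e n) ∈ K)
    (hKB : ∀ g ∈ K, ∀ n ∉ B, β.coord n (WeakDual.toStrongDual g) = 0) : β.DetectsSupport B := by
  rintro b ⟨M, hM⟩ n hn
  set M' := max M 1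
  have hM' : 0 < M' := lt_max_of_lt_right one_pos
  by_cases hb : StrongDual.toWeakDual (M'⁻¹ • b) ∈ K
  · have := hKB _ hb n hn
    change β.coord n (M'⁻¹ • b) = 0 at this
    rw [map_smul, smul_eq_mul] at this
    exact (mul_eq_zero.1 this).resolve_left (inv_ne_zero hM'.ne')
  · exfalso
    have := (WeakDual.withSeminorms ℝ X).toLocallyConvexSpace
    -- A weak-* continuous separating functional is evaluation at some `v`. As `±e n ∈ K`, the
    -- vector `u⁻¹ • v` satisfies the bounds over `B`, yet `b` exceeds `M' ≥ M` there.
    obtain ⟨F, u, hFK, hFb⟩ := geometric_hahn_banach_closed_point hKc hK.isClosed hb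
    obtain ⟨v, hv⟩ := LinearMap.dualEmbedding_surjective (B := topDualPairing ℝ X) F
    have hFv : ∀ g : WeakDual ℝ X, F g = g v := fun g => by rw [← hv]; rfl
    have hu : 0 < u := by simpa using hFK 0 hK0
    have hbv : b (u⁻¹ • v) ≤ M := by
      refine hM _ fun n hn => ?_
      have h1 := hFK _ (hKe n hn).1
      have h2 := hFK _ (hKe n hn).2
      rw [hFv] at h1 h2
      change β.e n v < u at h1
      change -β.e n v < u at h2
      rw [map_smul, smul_eq_mul, abs_mul, abs_of_pos (inv_pos.2 hu), inv_mul_le_iff₀ hu, mul_one,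
        abs_le]
      constructor <;> linarith
    rw [hFv] at hFb
    change u < M'⁻¹ * b v at hFb
    rw [map_smul, smul_eq_mul, inv_mul_le_iff₀ hu] at hbv
    rw [lt_inv_mul_iff₀ hM'] at hFb
    have : u * M ≤ M' * u := by rw [mul_comm]; gcongr; exact le_max_left _ _
    linarith

/-- The functionals in the dual unit ball which attain their norm at `x`. -/
def normAttaining (x : X) : Set (WeakDual ℝ X) :=
  {g | g x ≤ 1 ∧ ∀ v, g v ≤ g x * ‖v‖}

/-- The defining inequalities are linear in `g`; expressing norm attainment without the dual norm
makes both convexity and weak-* closedness immediate. -/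
theorem convex_normAttaining (x : X) : Convex ℝ (normAttaining x) := by
  rintro g ⟨hg1, hg⟩ h ⟨hh1, hh⟩ a b ha hb hab
  refine ⟨?_, fun v => ?_⟩
  · show a * g x + b * h x ≤ 1
    nlinarith
  · show a * g v + b * h v ≤ (a * g x + b * h x) * ‖v‖
    nlinarith [mul_le_mul_of_nonneg_left (hg v) ha, mul_le_mul_of_nonneg_left (hh v) hb]

theorem norm_le_of_mem_normAttaining {x : X} (hx : ‖x‖ = 1) {g : WeakDual ℝ X}
    (hg : g ∈ normAttaining x) : ‖WeakDual.toStrongDual g‖ ≤ g x := by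
  have h0 : 0 ≤ g x := by
    have := hg.2 (-x)
    rw [map_neg, norm_neg, hx] at this
    linarith
  refine ContinuousLinearMap.opNorm_le_bound _ h0 fun v => abs_le.2 ⟨?_, hg.2 v⟩
  have := hg.2 (-v)
  rw [map_neg, norm_neg] at this
  show -(g x * ‖v‖) ≤ g v
  linarith

theorem isCompact_normAttaining {x : X} (hx : ‖x‖ = 1) : IsCompact (normAttaining x) := by
  refine (WeakDual.isCompact_closedBall (𝕜 := ℝ) (0 : StrongDual ℝ X) 1).of_isClosed_subset ?_ ?_
  · have : normAttaining x = {g : WeakDual ℝ X | g x ≤ 1} ∩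
        ⋂ v : X, {g : WeakDual ℝ X | g v ≤ g x * ‖v‖} := by
      ext g; simp [normAttaining]
    rw [this]
    exact (isClosed_le (WeakDual.eval_continuous x) continuous_const).inter
      (isClosed_iInter fun v => isClosed_le (WeakDual.eval_continuous v)
        ((WeakDual.eval_continuous x).mul continuous_const))
  · intro g hg
    rw [Set.mem_preimage, mem_closedBall_zero_iff]
    exact (norm_le_of_mem_normAttaining hx hg).trans hg.1

/-- The series of `|coord m g| - coord m g * e m x` has nonnegative terms and sum `‖g‖ - g x ≤ 0`,
so every term vanishes. -/
theorem coord_eq_zero_of_norm_le_apply {x : X} (hx : ‖x‖ ≤ 1) {g : StrongDual ℝ X}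
    (hg : ‖g‖ ≤ g x) {n : ℕ} (hn : |β.e n x| < 1) : β.coord n g = 0 := by
  have hterm : ∀ m, 0 ≤ |β.coord m g| - β.coord m g * β.e m x := fun m => by
    have h1 : |β.e m x| ≤ 1 := (β.abs_e_le m x).trans hx
    have h2 : β.coord m g * β.e m x ≤ |β.coord m g| * |β.e m x| :=
      (le_abs_self _).trans_eq (abs_mul _ _)
    nlinarith [abs_nonneg (β.coord m g)]
  have h1 := le_hasSum ((β.hasSum_norm g).sub (β.hasSum_apply g x)) n fun m _ => hterm m
  have h2 : β.coord n g * β.e n x ≤ |β.coord n g| * |β.e n x| :=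
    (le_abs_self _).trans_eq (abs_mul _ _)
  by_contra hne
  have h3 : 0 < |β.coord n g| := abs_pos.2 hne
  nlinarith

open scoped Pointwise in
/-- If the basis functionals `e (m k)` converge weak-* to a functional attaining its norm at `x`,
then adding any subset of the indices `m k` to the contact set of `x` gives a set that detects
supports. -/
theorem detectsSupport_union_image {x : X} (hx : ‖x‖ = 1) (hx0 : ∀ n, 0 ≤ β.e n x)
    {m : ℕ → ℕ} {f : StrongDual ℝ X} (hf1 : ‖f‖ ≤ 1) (hfx : f x = 1)
    (hf : ∀ v, Filter.Tendsto (fun k => β.e (m k) v) Filter.atTop (nhds (f v))) (S : Set ℕ) :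
    β.DetectsSupport ({n | β.e n x = 1} ∪ m '' S) := by
  classical
  have hlt : ∀ n, β.e n x ≠ 1 → |β.e n x| < 1 := fun n hn =>
    lt_of_le_of_ne ((β.abs_e_le n x).trans hx.le) (by rwa [abs_of_nonneg (hx0 n)])
  -- Subtracting the limit makes the sequence weak-* null; zeros outside `S` restrict it without
  -- reindexing.
  let h : ℕ → StrongDual ℝ X := fun k => if k ∈ S then β.e (m k) - f else 0
  have hR : ∀ k, ‖h k‖ ≤ 2 := fun k => by
    simp only [h]
    split_ifs
    · refine (norm_sub_le _ _).trans ?_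
      rw [β.norm_e]; linarith
    · simp
  have h0 : ∀ v, Filter.Tendsto (fun k => h k v) Filter.atTop (nhds 0) := fun v => by
    have h1 : Filter.Tendsto (fun k => |β.e (m k) v - f v|) Filter.atTop (nhds 0) := by
      have := ((hf v).sub_const (f v)).abs
      rwa [sub_self, abs_zero] at this
    refine squeeze_zero_norm (fun k => ?_) h1
    simp only [h]
    split_ifs
    · rfl
    · simp
  set Q := normAttaining x
  have hQ0 : (0 : WeakDual ℝ X) ∈ Q := ⟨zero_le_one, fun v => by
    show (0 : ℝ) ≤ 0 * ‖v‖
    simp⟩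
  have hQ1 : ∀ g : StrongDual ℝ X, ‖g‖ ≤ 1 → g x = 1 → StrongDual.toWeakDual g ∈ Q := by
    intro g hg hgx
    refine ⟨hgx.le, fun v => ?_⟩
    show g v ≤ g x * ‖v‖
    rw [hgx]
    exact (le_abs_self _).trans (g.le_of_opNorm_le hg v)
  have hL0 : (0 : WeakDual ℝ X) ∈ absConvexSums h := by
    simpa using smul_mem_absConvexSums h (r := 0) (by simp) 0
  -- Contact functionals lie in `Q`, and `e (m k) = f + h k` with `f ∈ Q`; the summand `-Q` supplies
  -- the opposite signs. Members of `Q` are supported on the contact set.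
  refine β.detectsSupport_of_isCompact (K := Q + -Q + absConvexSums h)
    (((isCompact_normAttaining hx).add (isCompact_normAttaining hx).neg).add
      (isCompact_absConvexSums hR h0))
    (((convex_normAttaining x).add (convex_normAttaining x).neg).add (convex_absConvexSums hR))
    ⟨0, ⟨0, hQ0, 0, by simpa using hQ0, add_zero _⟩, 0, hL0, add_zero _⟩ ?_ ?_
  · rintro n (hn | ⟨k, hk, rfl⟩)
    · have hmem := hQ1 (β.e n) (β.norm_e n).le hn
      refine ⟨⟨_, ⟨_, hmem, 0, by simpa using hQ0, rfl⟩, 0, hL0, ?_⟩, ⟨_, ⟨0, hQ0, _, Set.neg_mem_neg.2 hmem, rfl⟩, 0, hL0, ?_⟩⟩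
      · simp
      · simp
    · have hmem := hQ1 f hf1 hfx
      have hh : h k = β.e (m k) - f := if_pos hk
      refine ⟨⟨_, ⟨_, hmem, 0, by simpa using hQ0, rfl⟩, _, smul_mem_absConvexSums h (r := 1) (by simp) k, ?_⟩,
        ⟨_, ⟨0, hQ0, _, Set.neg_mem_neg.2 hmem, rfl⟩, _, smul_mem_absConvexSums h (r := -1) (by simp) k, ?_⟩⟩
      · simp [hh]
      · simp [hh, sub_eq_add_neg]
  · rintro _ ⟨_, ⟨g, hg, g', hg', rfl⟩, l, hl, rfl⟩ n hn
    rw [Set.mem_union, not_or] at hn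
    have hn1 := hlt n hn.1
    have hQn : ∀ g ∈ Q, β.coord n (WeakDual.toStrongDual g) = 0 := fun g hg =>
      β.coord_eq_zero_of_norm_le_apply hx.le (norm_le_of_mem_normAttaining hx hg) hn1
    have hfn : β.coord n f = 0 :=
      β.coord_eq_zero_of_norm_le_apply hx.le (hf1.trans_eq hfx.symm) hn1
    have hln := β.coord_eq_zero_of_mem_absConvexSums hR (n := n) (fun k => by
      simp only [h]
      split_ifs with hk
      · have : n ≠ m k := fun h => hn.2 ⟨k, hk, h.symm⟩
        rw [map_sub, hfn, β.coord_e, if_neg this, sub_zero]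
      · simp) hl
    have hg'n : β.coord n (WeakDual.toStrongDual g') = 0 := by
      simpa using hQn _ hg'
    simp only [map_add, hQn g hg, hg'n, hln, add_zero]

end DualL1Basis

/-! ### Separability, and weak-* limits of basis functionals when (BD) fails. -/

theorem Submodule.exists_strongDual_eq_zero_of_notMem_topologicalClosure {X : Type*}
    [NormedAddCommGroup X] [NormedSpace ℝ X] {E : Submodule ℝ X} {v : X}
    (hv : v ∉ E.topologicalClosure) : ∃ g : StrongDual ℝ X, (∀ y ∈ E, g y = 0) ∧ g ≠ 0 := by
  obtain ⟨g, u, hg, hgv⟩ := geometric_hahn_banach_closed_point E.topologicalClosure.convex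
    E.isClosed_topologicalClosure hv
  have hu : 0 < u := by simpa using hg 0 (zero_mem _)
  refine ⟨g, fun y hy => ?_, fun h0 => ?_⟩
  · by_contra hne
    have := hg ((u / g y) • y) (Submodule.smul_mem _ _ (E.le_topologicalClosure hy))
    rw [map_smul, smul_eq_mul, div_mul_cancel₀ _ hne] at this
    exact lt_irrefl _ this
  · rw [h0] at hgv
    exact (hu.trans hgv).ne' rfl

theorem separableSpace_of_separableSpace_strongDual (X : Type*) [NormedAddCommGroup X]
    [NormedSpace ℝ X] [TopologicalSpace.SeparableSpace (StrongDual ℝ X)] :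
    TopologicalSpace.SeparableSpace X := by
  let D := TopologicalSpace.denseSeq (StrongDual ℝ X)
  have hD : ∀ n, ∃ y : X, ‖y‖ ≤ 1 ∧ ‖D n‖ / 2 ≤ |D n y| := by
    intro n
    rcases (norm_nonneg (D n)).eq_or_lt with h | h
    · exact ⟨0, by simp, by simp [← h]⟩
    · obtain ⟨y, hy, hyD⟩ := (D n).exists_lt_apply_of_lt_opNorm (half_lt_self h)
      exact ⟨y, hy.le, hyD.le⟩
  choose y hy hyD using hD
  let E := Submodule.span ℝ (Set.range y)
  have hE : (Set.univ : Set X) ⊆ closure (E : Set X) := by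
    intro v _
    by_contra hv
    obtain ⟨g, hg, hg0⟩ := Submodule.exists_strongDual_eq_zero_of_notMem_topologicalClosure
      (E := E) (v := v) hv
    have hgpos : 0 < ‖g‖ := norm_pos_iff.2 hg0
    -- Since `g` kills `y n`, `‖D n‖ / 2 ≤ ‖g - D n‖`, whence `‖g‖ ≤ 3 ‖g - D n‖`; a distance below
    -- `‖g‖ / 4` contradicts this.
    obtain ⟨n, hn⟩ := Metric.denseRange_iff.1 (TopologicalSpace.denseRange_denseSeq
      (StrongDual ℝ X)) g (‖g‖ / 4) (by linarith)
    rw [dist_eq_norm] at hn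
    have h1 : |D n (y n)| ≤ ‖g - D n‖ := by
      have h2 := (g - D n).le_opNorm (y n)
      have h3 : (g - D n) (y n) = -D n (y n) := by
        simp [hg (y n) (Submodule.subset_span ⟨n, rfl⟩)]
      rw [h3, norm_neg] at h2
      exact h2.trans (mul_le_of_le_one_right (norm_nonneg _) (hy n))
    have h4 : ‖g‖ ≤ ‖g - D n‖ + ‖D n‖ := by simpa using norm_add_le (g - D n) (D n)
    have h5 := hyD n
    have h6 : ‖g - D n‖ < ‖g‖ / 4 := hn
    linarith
  exact TopologicalSpace.isSeparable_univ_iff.1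
    (((Set.countable_range y).isSeparable.span (R := ℝ)).closure.mono hE)

namespace DualL1Basis

variable {X : Type*} [NormedAddCommGroup X] [NormedSpace ℝ X] (β : DualL1Basis X)

theorem separableSpace (β : DualL1Basis X) : TopologicalSpace.SeparableSpace X := by
  have : TopologicalSpace.SeparableSpace (StrongDual ℝ X) := by
    refine TopologicalSpace.isSeparable_univ_iff.1
      (((Set.countable_range β.e).isSeparable.span (R := ℝ)).closure.mono fun g _ => ?_)
    refine mem_closure_of_tendsto (β.hasSum g) (Filter.Eventually.of_forall fun s => ?_)
    exact Submodule.sum_mem _ fun n _ => Submodule.smul_mem _ _ (Submodule.subset_span ⟨n, rfl⟩)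
  exact separableSpace_of_separableSpace_strongDual X

theorem exists_tendsto_subseq (m : ℕ → ℕ) : ∃ f : StrongDual ℝ X, ∃ φ : ℕ → ℕ, StrictMono φ ∧
    ‖f‖ ≤ 1 ∧ ∀ v, Filter.Tendsto (fun k => β.e (m (φ k)) v) Filter.atTop (nhds (f v)) := by
  have := β.separableSpace
  obtain ⟨a, ha, φ, hφ, hlim⟩ := WeakDual.isSeqCompact_closedBall ℝ X
    (0 : StrongDual ℝ X) 1 (x := fun k => StrongDual.toWeakDual (β.e (m k)))
    (fun k => by
      rw [Set.mem_preimage, mem_closedBall_zero_iff]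
      exact (β.norm_e (m k)).le)
  refine ⟨WeakDual.toStrongDual a, φ, hφ, by simpa using ha, fun v => ?_⟩
  exact ((WeakDual.eval_continuous v).tendsto a).comp hlim

/-- The supremum is 1 but not attained, as attaining it would mean membership in `D(x)`. Strictly
increasing values thus tend to 1, which forces distinct basis indices; weak-* sequential compactness
gives the limit. -/
theorem exists_of_not_propertyBD (β : DualL1Basis X) (h : ¬ PropertyBD X) :
    ∃ (γ : DualL1Basis X) (x : X) (m : ℕ → ℕ) (f : StrongDual ℝ X), ‖x‖ = 1 ∧
      (∀ n, 0 ≤ γ.e n x) ∧ Function.Injective m ∧ (∀ k, γ.e (m k) x < 1) ∧ ‖f‖ ≤ 1 ∧ f x = 1 ∧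
      ∀ v, Filter.Tendsto (fun k => γ.e (m k) v) Filter.atTop (nhds (f v)) := by
  simp only [PropertyBD, not_forall, not_lt] at h
  obtain ⟨x, hx, hsup⟩ := h
  rw [mem_sphere_zero_iff_norm] at hx
  set T := (fun f : StrongDual ℝ X => f x) ''
    (Set.extremePoints ℝ (Metric.closedBall (0 : StrongDual ℝ X) 1) \ dualFace x) with hT
  have hTne : T.Nonempty := by
    by_contra hne
    -- The convention `sSup ∅ = 0` excludes the empty set here.
    rw [Set.not_nonempty_iff_eq_empty.1 hne, Real.sSup_empty] at hsup
    linarith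
  have hTlt : ∀ t ∈ T, t < 1 := by
    rintro _ ⟨g, ⟨hg, hgD⟩, rfl⟩
    have hg1 : ‖g‖ ≤ 1 := by simpa using hg.1
    have h1 := (le_abs_self _).trans (g.le_opNorm x)
    rw [hx, mul_one] at h1
    refine lt_of_le_of_ne (h1.trans hg1) fun h2 => hgD ⟨?_, h2⟩
    change g x = 1 at h2
    rw [h2] at h1
    simpa using le_antisymm hg1 h1
  have hbdd : BddAbove T := ⟨1, fun t ht => (hTlt t ht).le⟩
  have hsup1 : sSup T = 1 := le_antisymm (csSup_le hTne fun t ht => (hTlt t ht).le) hsup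
  have hlub : IsLUB T 1 := hsup1 ▸ isLUB_csSup hTne hbdd
  obtain ⟨u, hu, hu1, hulim, huT⟩ :=
    hlub.exists_seq_strictMono_tendsto_of_notMem (fun h => lt_irrefl _ (hTlt 1 h)) hTne
  -- Only positive values are kept, since the sign change replaces `e n x` by its absolute value.
  obtain ⟨K, hK⟩ := Filter.eventually_atTop.1 (hulim.eventually (lt_mem_nhds one_pos))
  let σ : ℕ → ℝ := fun n => if 0 ≤ β.e n x then 1 else -1
  have hσ : ∀ n, |σ n| = 1 := fun n => by simp only [σ]; split_ifs <;> simp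
  let γ := β.signChange σ hσ
  have hγ : ∀ n, γ.e n x = |β.e n x| := fun n => by
    show σ n * β.e n x = _
    simp only [σ]
    split_ifs with h
    · rw [one_mul, abs_of_nonneg h]
    · rw [abs_of_neg (not_le.1 h), neg_one_mul]
  have hex : ∀ k, ∃ n, γ.e n x = u (k + K) := by
    intro k
    obtain ⟨g, hg, hgu⟩ := huT (k + K)
    obtain ⟨n, τ, hτ, rfl⟩ := β.exists_eq_smul_e hg.1
    refine ⟨n, ?_⟩
    change τ * β.e n x = u (k + K) at hgu
    rw [hγ, ← abs_of_pos (hK (k + K) (Nat.le_add_left _ _)), ← hgu, abs_mul, hτ, one_mul]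
  choose m hm using hex
  obtain ⟨f, φ, hφ, hf1, hf⟩ := γ.exists_tendsto_subseq m
  refine ⟨γ, x, m ∘ φ, f, hx, fun n => by rw [hγ]; exact abs_nonneg _, fun i j hij => ?_,
    fun k => ?_, hf1, ?_, hf⟩
  · have h1 : u (φ i + K) = u (φ j + K) := by rw [← hm, ← hm]; exact congrArg (γ.e · x) hij
    exact hφ.injective (Nat.add_right_cancel (hu.injective h1))
  · simp only [Function.comp_apply, hm]; exact hu1 _
  · refine tendsto_nhds_unique (hf x) ?_
    simp only [hm]
    exact hulim.comp ((Filter.tendsto_add_atTop_nat K).comp hφ.tendsto_atTop)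

/-! ### Construction of the copy of `c`. -/

/-- A sequence `w` and a vector `u` such that all `u - 2 ∑_{k ∈ F} w k` belong to the unit ball
behave like the unit vectors and the constant sequence `1` in `c`. -/
theorem sum_abs_add_abs_le {w : ℕ → X} {u : X}
    (h : ∀ F : Finset ℕ, ‖u - (2 : ℝ) • ∑ k ∈ F, w k‖ ≤ 1) (t : Finset ℕ) (n : ℕ) :
    |β.e n (u - ∑ k ∈ t, w k)| + ∑ k ∈ t, |β.e n (w k)| ≤ 1 := by
  have hF : ∀ F : Finset ℕ, |β.e n u - 2 * ∑ k ∈ F, β.e n (w k)| ≤ 1 := fun F => by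
    simpa using (β.abs_e_le n _).trans (h F)
  have hsplit : ∀ p : ℕ → Prop, ∀ [DecidablePred p], ∑ k ∈ t, β.e n (w k) =
      ∑ k ∈ t with p k, β.e n (w k) + ∑ k ∈ t with ¬ p k, β.e n (w k) :=
    fun p _ => (Finset.sum_filter_add_sum_filter_not _ _ _).symm
  have habs : ∑ k ∈ t, |β.e n (w k)| =
      ∑ k ∈ t with 0 ≤ β.e n (w k), β.e n (w k) - ∑ k ∈ t with ¬ 0 ≤ β.e n (w k), β.e n (w k) := by
    rw [← Finset.sum_filter_add_sum_filter_not t (fun k => 0 ≤ β.e n (w k)), sub_eq_add_neg,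
      ← Finset.sum_neg_distrib]
    congr 1
    · exact Finset.sum_congr rfl fun k hk => abs_of_nonneg (Finset.mem_filter.1 hk).2
    · exact Finset.sum_congr rfl fun k hk =>
        abs_of_neg (not_le.1 (Finset.mem_filter.1 hk).2)
  have h1 := hsplit (fun k => 0 ≤ β.e n (w k))
  -- With `P` and `N` the sums of the nonnegative and negative terms, the left side is either `e n u
  -- - 2N` or `2P - e n u`, so these two choices of `F` suffice.
  have h2 := abs_le.1 (hF {k ∈ t | 0 ≤ β.e n (w k)})
  have h3 := abs_le.1 (hF {k ∈ t | ¬ 0 ≤ β.e n (w k)})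
  rw [map_sub, map_sum, habs, h1]
  rcases abs_cases (β.e n u - (∑ k ∈ t with 0 ≤ β.e n (w k), β.e n (w k) +
    ∑ k ∈ t with ¬ 0 ≤ β.e n (w k), β.e n (w k))) with ⟨h4, _⟩ | ⟨h4, _⟩ <;> rw [h4] <;> linarith

/-- A sequence `y` with limit `L` is sent to `L u + ∑ (y k - L) w k`. Its partial sums equal `L (u -
∑ w k) + ∑ y k w k`, of norm at most `‖y‖` by `sum_abs_add_abs_le`; conversely `e (m j)` recovers `y
j`. -/
theorem containsIsometricCopyOfC_of_forall_norm_le [CompleteSpace X] {w : ℕ → X} {u : X}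
    {m : ℕ → ℕ} (h : ∀ F : Finset ℕ, ‖u - (2 : ℝ) • ∑ k ∈ F, w k‖ ≤ 1)
    (hu : ∀ k, β.e (m k) u = 1) (hw : ∀ j k, β.e (m j) (w k) = if j = k then 1 else 0) :
    ContainsIsometricCopyOfC X := by
  have hbound := β.sum_abs_add_abs_le h
  choose L hL using fun y : ConvergentSeq => y.2
  let ev : ConvergentSeq → ℕ → ℝ := fun y => (y : lp (fun _ : ℕ => ℝ) ∞)
  have hL' : ∀ y, Filter.Tendsto (ev y) Filter.atTop (nhds (L y)) := hL
  have hev : ∀ y k, |ev y k| ≤ ‖y‖ := fun y k =>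
    lp.norm_apply_le_norm (by simp) (y : lp (fun _ : ℕ => ℝ) ∞) k
  have hLadd : ∀ y z, L (y + z) = L y + L z := fun y z =>
    tendsto_nhds_unique (hL' (y + z)) ((hL' y).add (hL' z))
  have hLsmul : ∀ (r : ℝ) y, L (r • y) = r * L y := fun r y =>
    tendsto_nhds_unique (hL' (r • y)) ((hL' y).const_mul r)
  have hLle : ∀ y, |L y| ≤ ‖y‖ := fun y => le_of_tendsto' (hL' y).abs (hev y)
  have hsum : ∀ y, Summable fun k => (ev y k - L y) • w k := by
    intro y
    rw [summable_iff_vanishing_norm]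
    intro ε hε
    obtain ⟨N, hN⟩ := Metric.tendsto_atTop.1 (hL' y) (ε / 2) (by linarith)
    refine ⟨Finset.range N, fun t ht => ?_⟩
    refine (β.norm_le_of_forall (C := ε / 2) fun n => ?_).trans_lt (by linarith)
    rw [map_sum]
    calc |∑ k ∈ t, β.e n ((ev y k - L y) • w k)|
        ≤ ∑ k ∈ t, |β.e n ((ev y k - L y) • w k)| := Finset.abs_sum_le_sum_abs _ _
      _ ≤ ∑ k ∈ t, ε / 2 * |β.e n (w k)| := by
        refine Finset.sum_le_sum fun k hk => ?_
        rw [map_smul, smul_eq_mul, abs_mul]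
        have hkN : N ≤ k := by
          by_contra hlt
          exact Finset.disjoint_left.1 ht hk (Finset.mem_range.2 (not_le.1 hlt))
        have := hN k hkN
        rw [Real.dist_eq] at this
        exact mul_le_mul_of_nonneg_right this.le (abs_nonneg _)
      _ = ε / 2 * ∑ k ∈ t, |β.e n (w k)| := by rw [Finset.mul_sum]
      _ ≤ ε / 2 := by
        have := hbound t n
        have := abs_nonneg (β.e n (u - ∑ k ∈ t, w k))
        nlinarith
  let T : ConvergentSeq →ₗ[ℝ] X :=
    { toFun := fun y => L y • u + ∑' k, (ev y k - L y) • w k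
      map_add' := fun y z => by
        have h1 : (fun k => (ev (y + z) k - L (y + z)) • w k) =
            fun k => (ev y k - L y) • w k + (ev z k - L z) • w k := by
          funext k
          rw [hLadd, ← add_smul]
          congr 1
          show ev y k + ev z k - _ = _
          ring
        rw [h1, (hsum y).tsum_add (hsum z), hLadd, add_smul]
        abel
      map_smul' := fun r y => by
        have h1 : (fun k => (ev (r • y) k - L (r • y)) • w k) =
            fun k => r • ((ev y k - L y) • w k) := by
          funext k
          rw [hLsmul, smul_smul]
          congr 1
          show r * ev y k - _ = _
          ring
        rw [h1, (hsum y).tsum_const_smul r, hLsmul, mul_smul, RingHom.id_apply, smul_add] }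
  have hTle : ∀ y, ‖T y‖ ≤ ‖y‖ := by
    intro y
    have hlim : Filter.Tendsto
        (fun N => L y • u + ∑ k ∈ Finset.range N, (ev y k - L y) • w k) Filter.atTop
        (nhds (T y)) := (hsum y).hasSum.tendsto_sum_nat.const_add _
    refine le_of_tendsto' hlim.norm fun N => β.norm_le_of_forall fun n => ?_
    have h1 : L y • u + ∑ k ∈ Finset.range N, (ev y k - L y) • w k =
        L y • (u - ∑ k ∈ Finset.range N, w k) + ∑ k ∈ Finset.range N, ev y k • w k := by
      simp only [sub_smul, Finset.sum_sub_distrib, smul_sub, Finset.smul_sum]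
      abel
    rw [h1, map_add, map_smul, map_sum, smul_eq_mul]
    calc _ ≤ |L y * β.e n (u - ∑ k ∈ Finset.range N, w k)| +
          |∑ k ∈ Finset.range N, β.e n (ev y k • w k)| := abs_add_le _ _
      _ ≤ ‖y‖ * |β.e n (u - ∑ k ∈ Finset.range N, w k)| +
          ∑ k ∈ Finset.range N, ‖y‖ * |β.e n (w k)| := by
        gcongr
        · rw [abs_mul]; gcongr; exact hLle y
        · refine (Finset.abs_sum_le_sum_abs _ _).trans (Finset.sum_le_sum fun k _ => ?_)
          rw [map_smul, smul_eq_mul, abs_mul]; gcongr; exact hev y k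
      _ = ‖y‖ * (|β.e n (u - ∑ k ∈ Finset.range N, w k)| +
          ∑ k ∈ Finset.range N, |β.e n (w k)|) := by rw [mul_add, Finset.mul_sum]
      _ ≤ ‖y‖ := mul_le_of_le_one_right (norm_nonneg _) (hbound _ n)
  have hTe : ∀ y j, β.e (m j) (T y) = ev y j := by
    intro y j
    show β.e (m j) (L y • u + ∑' k, (ev y k - L y) • w k) = ev y j
    rw [map_add, map_smul, hu, (β.e (m j)).map_tsum (hsum y), tsum_eq_single j]
    · simp [hw]
    · intro k hk
      simp [hw, hk.symm]
  refine ⟨⟨T, fun y => le_antisymm (hTle y) ?_⟩⟩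
  refine lp.norm_le_of_forall_le (f := (y : lp (fun _ : ℕ => ℝ) ∞)) (norm_nonneg _) fun j => ?_
  show |ev y j| ≤ ‖T y‖
  rw [← hTe]
  exact β.abs_e_le _ _

/-- If basis functionals outside the contact set of `x` converge weak-* to a functional attaining
its norm at `x`, then the space contains an isometric copy of `c`. -/
theorem containsIsometricCopyOfC_of_tendsto [CompleteSpace X] {x : X} (hx : ‖x‖ = 1)
    (hx0 : ∀ n, 0 ≤ β.e n x) {m : ℕ → ℕ} (hm : Function.Injective m)
    (hmx : ∀ k, β.e (m k) x < 1) {f : StrongDual ℝ X} (hf1 : ‖f‖ ≤ 1) (hfx : f x = 1)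
    (hf : ∀ v, Filter.Tendsto (fun k => β.e (m k) v) Filter.atTop (nhds (f v))) :
    ContainsIsometricCopyOfC X := by
  classical
  set A : Set ℕ := {n | β.e n x = 1} with hA
  set B : Set ℕ := A ∪ m '' Set.univ with hB
  have hmB : ∀ k, m k ∈ B := fun k => Or.inr ⟨k, trivial, rfl⟩
  have hdet : ∀ S, β.DetectsSupport (A ∪ m '' S) :=
    β.detectsSupport_union_image hx hx0 hf1 hfx hf
  have happrox : ∀ k, ∀ ε > 0, ∃ p : X, ∀ n ∈ B, |β.e n p - if n = m k then 2 else 0| ≤ ε := by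
    intro k ε hε
    have hk : m k ∉ A ∪ m '' {k}ᶜ := by
      rintro (h | ⟨j, hj, hjk⟩)
      · exact (hmx k).ne h
      · exact hj (hm hjk)
    have hunb : ¬ ∃ M, ∀ v, (∀ n ∈ A ∪ m '' {k}ᶜ, |β.e n v| ≤ 1) → β.e (m k) v ≤ M := fun h => by
      -- A bound would force `e (m k)` to be supported away from its own index. Rescaling vectors
      -- where it is large approximates twice the indicator of `m k` on `B`.
      simpa [β.coord_e] using hdet _ (β.e (m k)) h (m k) hk
    push Not at hunb
    obtain ⟨v, hv, hvk⟩ := hunb (2 / ε)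
    have hpos : 0 < β.e (m k) v := (by positivity : 0 < 2 / ε).trans hvk
    refine ⟨(2 / β.e (m k) v) • v, fun n hn => ?_⟩
    rw [map_smul, smul_eq_mul]
    split_ifs with hnk
    · rw [hnk, div_mul_cancel₀ _ hpos.ne', sub_self, abs_zero]; exact hε.le
    · have hn' : n ∈ A ∪ m '' {k}ᶜ := by
        rcases hn with hn | ⟨j, -, rfl⟩
        · exact Or.inl hn
        · exact Or.inr ⟨j, fun h => hnk (by rw [h]), rfl⟩
      rw [sub_zero, abs_mul, abs_of_pos (div_pos two_pos hpos)]
      refine (mul_le_of_le_one_right (div_pos two_pos hpos).le (hv n hn')).trans ?_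
      rw [div_le_iff₀ hpos]
      rw [div_lt_iff₀ hε] at hvk
      linarith
  have hstep : ∀ k (C : Finset X), (∀ c ∈ C, ‖c‖ ≤ 1 ∧ β.e (m k) c = 1) →
      ∃ w : X, (∀ n ∈ B, β.e n w = if n = m k then 1 else 0) ∧
        ∀ c ∈ C, ‖c - (2 : ℝ) • w‖ ≤ 1 := by
    intro k C hC
    -- The value 2 is at distance 1 from `e (m k) c = 1`, and 0 is within 1 of every other value of
    -- `c`; then `w` is half of `z`.
    obtain ⟨z, hzB, hzC⟩ := β.exists_eqOn_forall_norm_sub_le (hdet Set.univ) (C := C)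
      (s := fun n => if n = m k then 2 else 0) (M := 2)
      (fun n => by split_ifs <;> simp)
      (fun c hc n => by
        split_ifs with hn
        · rw [hn, (hC c hc).2]; norm_num
        · rw [zero_sub, abs_neg]; exact (β.abs_e_le n c).trans (hC c hc).1) (happrox k)
    refine ⟨(1 / 2 : ℝ) • z, fun n hn => ?_, fun c hc => ?_⟩
    · rw [map_smul, hzB n hn]; split_ifs <;> simp
    · rw [smul_smul, show (2 : ℝ) * (1 / 2) = 1 by norm_num, one_smul, norm_sub_rev]
      exact hzC c hc
  obtain ⟨u, huB, hu1⟩ : ∃ u : X, (∀ n ∈ B, β.e n u = 1) ∧ ‖u‖ ≤ 1 := by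
    have happ : ∀ ε > 0, ∃ p : X, ∀ n ∈ B, |β.e n p - 1| ≤ ε := by
      intro ε hε
      choose w hw using fun k => hstep k ∅ (by simp)
      have hlim := hf x
      rw [hfx] at hlim
      obtain ⟨N, hN⟩ := Metric.tendsto_atTop.1 hlim ε hε
      -- On the contact set `x` is already 1, and `e (m k) x` tends to 1, so only finitely many
      -- values need correction.
      refine ⟨x + ∑ k ∈ Finset.range N, (1 - β.e (m k) x) • w k, fun n hn => ?_⟩
      have hval : β.e n (x + ∑ k ∈ Finset.range N, (1 - β.e (m k) x) • w k) =
          β.e n x + ∑ k ∈ Finset.range N, if n = m k then 1 - β.e (m k) x else 0 := by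
        rw [map_add, map_sum]
        congr 1
        refine Finset.sum_congr rfl fun k _ => ?_
        rw [map_smul, (hw k).1 n hn]; split_ifs <;> simp
      rw [hval]
      rcases hn with hn | ⟨j, -, rfl⟩
      · rw [Finset.sum_eq_zero, show β.e n x = 1 from hn]
        · simpa using hε.le
        · intro k _
          rw [if_neg]
          rintro rfl
          exact (hmx k).ne hn
      · simp only [hm.eq_iff, Finset.sum_ite_eq, Finset.mem_range]
        split_ifs with hj
        · simpa using hε.le
        · have := hN j (not_lt.1 hj)
          rw [Real.dist_eq] at this
          simpa using this.le
    obtain ⟨u, huB, hu⟩ := β.exists_eqOn_forall_norm_sub_le (hdet Set.univ) (C := {0})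
      (s := fun _ => 1) (M := 1) (fun n => by simp) (fun c hc n => by
        rw [Finset.mem_singleton] at hc; simp [hc]) happ
    exact ⟨u, huB, by simpa using hu 0 (by simp)⟩
  choose! W hWB hWC using hstep
  -- `C N` collects all `u - 2 ∑ w k` over subsets of the first `N` indices. Subtracting `2 w N`
  -- alters the value at `m N` but leaves the later values 1, so the next step still applies.
  let C : ℕ → Finset X := fun N =>
    Nat.rec {u} (fun k C => C ∪ C.image fun c => c - (2 : ℝ) • W k C) N
  let w : ℕ → X := fun k => W k (C k)
  have hCsucc : ∀ N, C (N + 1) = C N ∪ (C N).image fun c => c - (2 : ℝ) • w N := fun N => rfl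
  have hC : ∀ N, ∀ c ∈ C N, ‖c‖ ≤ 1 ∧ ∀ k, N ≤ k → β.e (m k) c = 1 := by
    intro N
    induction N with
    | zero =>
      intro c hc
      rw [show c = u from Finset.mem_singleton.1 hc]
      exact ⟨hu1, fun k _ => huB _ (hmB k)⟩
    | succ N ih =>
      have hN : ∀ c ∈ C N, ‖c‖ ≤ 1 ∧ β.e (m N) c = 1 := fun c hc =>
        ⟨(ih c hc).1, (ih c hc).2 N le_rfl⟩
      intro c hc
      rw [hCsucc, Finset.mem_union, Finset.mem_image] at hc
      rcases hc with hc | ⟨c, hc, rfl⟩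
      · exact ⟨(ih c hc).1, fun k hk => (ih c hc).2 k (by omega)⟩
      · refine ⟨hWC N (C N) hN c hc, fun k hk => ?_⟩
        have hne : m k ≠ m N := fun h => by have := hm h; omega
        rw [map_sub, map_smul, (ih c hc).2 k (by omega), hWB N (C N) hN _ (hmB k), if_neg hne]
        simp
  have hmem : ∀ N, ∀ F ⊆ Finset.range N, u - (2 : ℝ) • ∑ k ∈ F, w k ∈ C N := by
    intro N
    induction N with
    | zero =>
      intro F hF
      rw [Finset.range_zero, Finset.subset_empty] at hF
      rw [hF, Finset.sum_empty, smul_zero, sub_zero]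
      exact Finset.mem_singleton_self u
    | succ N ih =>
      intro F hF
      rw [Finset.range_add_one, Finset.subset_insert_iff] at hF
      have := ih _ hF
      rw [hCsucc, Finset.mem_union, Finset.mem_image]
      by_cases hNF : N ∈ F
      · refine Or.inr ⟨_, this, ?_⟩
        rw [← Finset.add_sum_erase F w hNF, smul_add]
        abel
      · rw [Finset.erase_eq_of_notMem hNF] at this
        exact Or.inl this
  refine β.containsIsometricCopyOfC_of_forall_norm_le (w := w) (u := u) (m := m) (fun F => ?_)
    (fun k => huB _ (hmB k)) (fun j k => ?_)
  · obtain ⟨N, hN⟩ := F.exists_nat_subset_range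
    exact (hC N _ (hmem N F hN)).1
  · rw [hWB k (C k) (fun c hc => ⟨(hC k c hc).1, (hC k c hc).2 k le_rfl⟩) _ (hmB j)]
    simp [hm.eq_iff]

end DualL1Basis

theorem theorem2p1 (X : Type*) [NormedAddCommGroup X] [NormedSpace ℝ X] [CompleteSpace X]
    (hX : IsPredualL1 X) :
    List.TFAE [IsPolyhedral X, ¬ ContainsIsometricCopyOfC X, PropertyBD X] := by
  obtain ⟨β⟩ := hX.nonempty_basis
  tfae_have 1 → 2 := fun h => h.not_containsIsometricCopyOfC
  tfae_have 2 → 3 := fun h => by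
    by_contra hBD
    obtain ⟨γ, x, m, f, hx, hx0, hm, hmx, hf1, hfx, hf⟩ := β.exists_of_not_propertyBD hBD
    exact h (γ.containsIsometricCopyOfC_of_tendsto hx hx0 hm hmx hf1 hfx hf)
  tfae_have 3 → 1 := fun h => h.isPolyhedral β
  tfae_finish
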